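/- **Setting.** There are $K$ arms, a measurable context space $\mathcal X$, and $N$ stochastic experts $\pi_1,\dots,\pi_N$, each a conditional distribution $\pi_i(v\mid x)$ of an arm given a context. In each time step nature draws a context and rewards $(x,r_1,\dots,r_K)$, $r_v\in[0,1]$, from a fixed probability distribution; if expert $k$ is followed, an arm $v$ is drawn from $\pi_k(\cdot\mid x)$ and $y=r_v$ is observed. Let $p_k$ be the resulting law of $(X,V,Y)$, $\mu_k=\mathbb E_{p_k}[Y]$, $\mu^*=\max_k\mu_k$, $\Delta_k=\mu^*-\mu_k$, and let $0=\Delta_{(1)}\le\dots\le\Delta_{(N)}$ be the gaps in nondecreasing order. Let $\sigma_{ij}^2=1+\mathbb E_{p_j}\big[\big(\tfrac{\pi_i(V\mid X)}{\pi_j(V\mid X)}\big)^2-1\big]$, that is, one plus the conditional chi-square divergence of $\pi_i$ from $\pi_j$ (infinite if $\pi_i(\cdot\mid x)\not\ll\pi_j(\cdot\mid x)$ with positive probability), and $\sigma=\max_{i,j}\sigma_{ij}$. **Algorithm (D-UCB with the importance-sampling median-of-means estimator).** Put $\delta(t)=1/t^2$ and $l(t)=\lfloor 8\log(1/\delta(t))\rfloor$.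 At time $t$ the samples of the times $1,\dots,t$ are divided into $l(t)$ groups by a rule that places the samples one after the other, looking only at the experts followed so far, such that every group contains at least $\lfloor n_i(t)/l(t)\rfloor$ of the $n_i(t)$ samples of each expert $i$ and at least $\lfloor t/(2l(t))\rfloor$ samples in all. Let $\mathcal T^{(r)}_j$ be the set of times of the samples from expert $j$ in group $r$, $n_j(r,t)=|\mathcal T^{(r)}_j|$, $n(r,t)=\sum_j n_j(r,t)$, $W_k(r,t)=\sum_j n_j(r,t)/\sigma_{kj}$, $W_k(t)=\min_r W_k(r,t)/n(r,t)$, $$\hat\mu_k^{(r)}(t)=\frac1{W_k(r,t)}\sum_{j=1}^N\sum_{s\in\mathcal T^{(r)}_j}\frac1{\sigma_{kj}}\,y_s\,\frac{\pi_k(v_s\mid x_s)}{\pi_j(v_s\mid x_s)},\qquad U_k(t)=\operatorname{median}_{r}\hat\mu^{(r)}_k(t)+\frac1{W_k(t)}\sqrt{\frac{64\log(1/\delta(t))}{t}}.$$ The first expert is chosen at random (with any distribution); at time $t+1\ge2$ an expert $k(t+1)\in\arg\max_kU_k(t)$ is followed, with ties broken arbitrarily. If $U(t)$ is undefined because $l(t)=0$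 or some group is empty (which can happen only for $t$ below an absolute constant), the next expert is arbitrary. The (expected) regret is $R(T)=\mathbb E\sum_{t=1}^T(\mu^*-\mu_{k(t)})$. **Theorem.** There is a universal constant $C_2>0$ such that, for every such bandit with all $\sigma_{ij}$ finite, every such division rule and every $T\ge1$, $$R(T)\le\frac{C_2\sigma^2\log T}{\Delta_{(N)}}+\sum_{k=2}^{N-1}\frac{C_2\sigma^2\log T}{\Delta_{(k)}}\Big(1-\frac{\Delta_{(k)}^2}{\Delta_{(k+1)}^2}\Big)+\frac{\pi^2}{3}\sum_{i=2}^N\Delta_{(i)},$$ where any of the first $N-1$ terms whose denominator $\Delta_{(k)}$ (or $\Delta_{(N)}$) is $0$ is read as $0$. -/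

import Mathlib

open MeasureTheory ProbabilityTheory

noncomputable section

/-- A contextual bandit with `K` arms and `N` stochastic experts on the context space `𝒳`.
`nature` is the joint law of the context and of the rewards `r_1, …, r_K ∈ [0,1]` of the arms in
one time step; `expert i` is the conditional distribution `π_i(v | x)` of the arm given the
context. -/
structure ExpertBandit (𝒳 : Type*) [MeasurableSpace 𝒳] (K N : ℕ) where
  nature : Measure (𝒳 × (Fin K → ℝ))
  isProbabilityMeasure : IsProbabilityMeasure nature
  reward_mem : ∀ᵐ z ∂nature, ∀ v, z.2 v ∈ Set.Icc (0 : ℝ) 1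
  expert : Fin N → Kernel 𝒳 (Fin K)
  isMarkovKernel : ∀ i, IsMarkovKernel (expert i)

namespace ExpertBandit

variable {𝒳 : Type*} [MeasurableSpace 𝒳] {K N : ℕ} (B : ExpertBandit 𝒳 K N)

/-- `π_i(v | x)`. -/
def prob (i : Fin N) (x : 𝒳) (v : Fin K) : ℝ := (B.expert i x).real {v}

/-- The importance ratio `π_i(v | x) / π_j(v | x)`. -/
def ratio (i j : Fin N) (x : 𝒳) (v : Fin K) : ℝ := B.prob i x v / B.prob j x v

/-- `p_k`, the joint law of (context, arm, observed reward) in a time step in which expert `k` is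
followed: the context and the rewards are drawn from `nature`, the arm from `π_k(· | x)`, and the
reward of the drawn arm is observed. -/
def law (k : Fin N) : Measure (𝒳 × Fin K × ℝ) :=
  (B.nature ⊗ₘ Kernel.prodMkRight (Fin K → ℝ) (B.expert k)).map
    fun z => (z.1.1, z.2, z.1.2 z.2)

/-- `μ_k`, the mean reward of expert `k`. -/
def mean (k : Fin N) : ℝ := ∫ z, z.2.2 ∂B.law k

/-- `μ* = max_k μ_k`. -/
def bestMean : ℝ := ⨆ k, B.mean k

/-- `Δ_k = μ* - μ_k`. -/
def gap (k : Fin N) : ℝ := B.bestMean - B.mean k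

/-- `Δ_(k)` for `k = 1, …, N`: the gaps in nondecreasing order (and `0` for other `k`). -/
def sortedGap (k : ℕ) : ℝ :=
  if h : 1 ≤ k ∧ k ≤ N then B.gap (Tuple.sort B.gap ⟨k - 1, by omega⟩) else 0

/-- The conditional `f`-divergence `D_f(π_i ‖ π_j) = E_{p_j}[f(π_i(V|X) / π_j(V|X))]`. -/
def condFDiv (f : ℝ → ℝ) (i j : Fin N) : ℝ := ∫ z, f (B.ratio i j z.1 z.2.1) ∂B.law j

/-- `σ_ij`, where `σ_ij² = 1 + D_f(π_i ‖ π_j)` with `f(x) = x² - 1`. -/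
def sigma (i j : Fin N) : ℝ := √(1 + B.condFDiv (fun x => x ^ 2 - 1) i j)

/-- All pairwise chi-square divergences are finite: as usual this means that `π_i(· | x)` is
absolutely continuous with respect to `π_j(· | x)` for almost every context `x`, and that the
integral that defines the divergence converges. -/
def ChiSquareFinite : Prop :=
  ∀ i j, (∀ᵐ z ∂B.nature, ∀ v, B.prob j z.1 v = 0 → B.prob i z.1 v = 0) ∧
    Integrable (fun z => B.ratio i j z.1 z.2.1 ^ 2 - 1) (B.law j)

/-- `σ = max_{i,j} σ_ij`. -/
def sigmaMax : ℝ := ⨆ p : Fin N × Fin N, B.sigma p.1 p.2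

end ExpertBandit

/-- `δ(t) = 1 / t²`. -/
def delta (t : ℕ) : ℝ := 1 / (t : ℝ) ^ 2

/-- The number of groups `l(t) = ⌊8 log (1 / δ(t))⌋`. -/
def numGroups (t : ℕ) : ℕ := ⌊8 * Real.log (1 / delta t)⌋₊

/-- A rule that divides, for each `t`, the samples of the times `1, …, t` into the groups
`0, …, l(t) - 1`. If `h s` is the expert followed at time `s`, the sample of time `s` goes to
group `assign t h s`.

The samples are placed one after the other, by looking only at the experts followed so far. Every
group receives at least `⌊n_i(t) / l(t)⌋` samples of every expert `i`, so that the fractions of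
the experts are preserved, and no group falls short of half of its share `t / l(t)` of all
samples (rounded down). -/
structure Division (N : ℕ) where
  assign : ℕ → (ℕ → Fin N) → ℕ → ℕ
  assign_congr : ∀ (t : ℕ) (h h' : ℕ → Fin N) (s : ℕ),
    (∀ u ∈ Finset.Icc 1 s, h u = h' u) → assign t h s = assign t h' s
  assign_lt : ∀ (t : ℕ) (h : ℕ → Fin N), 1 ≤ numGroups t →
    ∀ s ∈ Finset.Icc 1 t, assign t h s < numGroups t
  expert_share : ∀ (t : ℕ) (h : ℕ → Fin N), ∀ r < numGroups t, ∀ i : Fin N,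
    ((Finset.Icc 1 t).filter fun s => h s = i).card / numGroups t ≤
      ((Finset.Icc 1 t).filter fun s => h s = i ∧ assign t h s = r).card
  group_size : ∀ (t : ℕ) (h : ℕ → Fin N), ∀ r < numGroups t,
    t / (2 * numGroups t) ≤ ((Finset.Icc 1 t).filter fun s => assign t h s = r).card

namespace Division

variable {N : ℕ} (D : Division N)

/-- `𝒯_j^(r)`: the times up to `t` whose sample comes from expert `j` and lies in group `r`. -/
def samples (t : ℕ) (h : ℕ → Fin N) (r : ℕ) (j : Fin N) : Finset ℕ :=
  (Finset.Icc 1 t).filter fun s => h s = j ∧ D.assign t h s = r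

/-- `n(r,t) = ∑_i n_i(r,t)`, the size of group `r`. -/
def size (t : ℕ) (h : ℕ → Fin N) (r : ℕ) : ℕ := ∑ i, (D.samples t h r i).card

end Division

/-- The median of finitely many reals: the mean of the two middle entries of the sorted list, which
coincide if the number of entries is odd. -/
def median {n : ℕ} (f : Fin n → ℝ) : ℝ :=
  if h : 0 < n then
    (f (Tuple.sort f ⟨(n - 1) / 2, by omega⟩) + f (Tuple.sort f ⟨n / 2, by omega⟩)) / 2
  else 0

namespace ExpertBandit

variable {𝒳 : Type*} [MeasurableSpace 𝒳] {K N : ℕ} (B : ExpertBandit 𝒳 K N) (D : Division N)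

/-- `W_k(r,t) = ∑_i n_i(r,t) / σ_ki`. -/
def groupWeight (t : ℕ) (h : ℕ → Fin N) (k : Fin N) (r : ℕ) : ℝ :=
  ∑ i, ((D.samples t h r i).card : ℝ) / B.sigma k i

/-- The importance sampling estimate of the mean of expert `k` from group `r`; `z s` is the
observation (context, arm, reward) of time `s`. -/
def groupMean (t : ℕ) (h : ℕ → Fin N) (z : ℕ → 𝒳 × Fin K × ℝ) (k : Fin N) (r : ℕ) : ℝ :=
  1 / B.groupWeight D t h k r *
    ∑ j, ∑ s ∈ D.samples t h r j,
      1 / B.sigma k j * (z s).2.2 * B.ratio k j (z s).1 (z s).2.1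

/-- The median of means estimator of the mean of expert `k` at time `t`. -/
def momEstimate (t : ℕ) (h : ℕ → Fin N) (z : ℕ → 𝒳 × Fin K × ℝ) (k : Fin N) : ℝ :=
  median fun r : Fin (numGroups t) => B.groupMean D t h z k r

/-- `W_k(t) = min_r W_k(r,t) / n(r,t)`. -/
def minWeight (t : ℕ) (h : ℕ → Fin N) (k : Fin N) : ℝ :=
  ⨅ r : Fin (numGroups t), B.groupWeight D t h k r / (D.size t h r : ℝ)

/-- The confidence width `s_k(t) = (1 / W_k(t)) √(64 log (1 / δ(t)) / t)`. -/
def width (t : ℕ) (h : ℕ → Fin N) (k : Fin N) : ℝ :=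
  1 / B.minWeight D t h k * √(64 * Real.log (1 / delta t) / t)

/-- The upper confidence index `U_k(t)`. -/
def ucb (t : ℕ) (h : ℕ → Fin N) (z : ℕ → 𝒳 × Fin K × ℝ) (k : Fin N) : ℝ :=
  B.momEstimate D t h z k + B.width D t h k

end ExpertBandit

/-- The information available before time `t`: experts and observations of the times
`1, …, t - 1`. -/
@[reducible]
def pastInfo {Ω 𝒳 : Type*} [MeasurableSpace 𝒳] {K N : ℕ} (k : ℕ → Ω → Fin N)
    (Z : ℕ → Ω → 𝒳 × Fin K × ℝ) (t : ℕ) : MeasurableSpace Ω :=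
  ⨆ s ∈ Finset.Ico 1 t,
    MeasurableSpace.comap (k s) inferInstance ⊔ MeasurableSpace.comap (Z s) inferInstance

/-- `k` (expert followed) and `Z` (context, arm, reward), at the times `1, 2, …`, are a run of
D-UCB with the median of means estimator on the bandit `B`.

* `observe`: given the past and the choice `k t = j`, the observation of time `t` has law `p_j`.
* `choose`: the expert of time `t + 1` maximizes the index `U(t)`; ties may be broken in any way.

The first expert may be drawn in any way. The index `U(t)` only makes sense if there is at least
one group and no group is empty; while this fails (only for `t` below an absolute constant, such as
`t = 1`, where `l(t) = 0`), any expert may be followed next. -/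
structure IsDUCBRun {Ω 𝒳 : Type*} [MeasurableSpace Ω] [MeasurableSpace 𝒳] {K N : ℕ}
    (B : ExpertBandit 𝒳 K N) (D : Division N) (P : Measure Ω)
    (k : ℕ → Ω → Fin N) (Z : ℕ → Ω → 𝒳 × Fin K × ℝ) : Prop where
  measurable_expert : ∀ t, Measurable (k t)
  measurable_obs : ∀ t, Measurable (Z t)
  observe : ∀ t, 1 ≤ t → ∀ A, MeasurableSet[pastInfo k Z t] A → ∀ (j : Fin N) (S : Set _),
    MeasurableSet S → P (A ∩ k t ⁻¹' {j} ∩ Z t ⁻¹' S) = P (A ∩ k t ⁻¹' {j}) * B.law j S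
  choose : ∀ t, 1 ≤ t → ∀ᵐ ω ∂P,
    1 ≤ numGroups t → (∀ r < numGroups t, 1 ≤ D.size t (fun s => k s ω) r) →
    ∀ j, B.ucb D t (fun s => k s ω) (fun s => Z s ω) j ≤
      B.ucb D t (fun s => k s ω) (fun s => Z s ω) (k (t + 1) ω)

/-- The (expected) regret `R(T) = E ∑_{t=1}^T (μ* - μ_{k(t)})`. -/
def regret {Ω 𝒳 : Type*} [MeasurableSpace Ω] [MeasurableSpace 𝒳] {K N : ℕ}
    (B : ExpertBandit 𝒳 K N) (P : Measure Ω) (k : ℕ → Ω → Fin N) (T : ℕ) : ℝ :=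
  ∫ ω, ∑ t ∈ Finset.Icc 1 T, (B.bestMean - B.mean (k t ω)) ∂P

end

/-!
Given the past, the importance-sampling score of a sample (its importance-weighted reward, centred
and divided by `σ i j`) has mean zero and second moment at most one, whichever expert `j` was
followed. A convex potential of the score sum of one group, suitably discounted by the size of the
group, therefore does not increase in expectation, and neither does the product over the groups of
`1 +` potential. The potential is exponential for the lower tail, where the scores are bounded on
one side, and quadratic for the upper tail, where they are only square integrable. Each factor
starts at `3 / 2`, is at least `1`, and is at least `3` for a deviating group; so by Markov's
inequality half of the groups, and with them the median, deviate with probability at most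
`(√3 / 2) ^ l(t) ≤ 1 / (2 t ^ 2)`.

Hence an expert whose gap exceeds four confidence widths is followed with probability at most
`1 / t ^ 2`, which accounts for the constant through `ζ(2)`. The smaller gaps are cut into layers
`Δ (i) - Δ (i - 1)`; layer `i` costs regret only while `t Δ (i) ^ 2 < M`, that is, for at most
`M / Δ (i) ^ 2` steps, and summation by parts turns these costs into the logarithmic terms.
-/

open Finset

lemma exp_le_one_add_add_sq {x : ℝ} (hx : x ≤ 1 / 2) : Real.exp x ≤ 1 + x + 5 / 8 * x ^ 2 := by
  rcases le_total 0 x with h0 | h0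
  · have h := Real.exp_bound' h0 (by linarith) (n := 3) (by norm_num)
    norm_num [sum_range_succ, Nat.factorial] at h
    nlinarith [mul_nonneg (sq_nonneg x) (sub_nonneg.2 hx)]
  · have hquad := Real.quadratic_le_exp_of_nonneg (neg_nonneg.2 h0)
    have hinv : Real.exp x * Real.exp (-x) = 1 := by
      rw [← Real.exp_add, add_neg_cancel, Real.exp_zero]
    have hpos : 0 < 1 + -x + (-x) ^ 2 / 2 := by nlinarith [sq_nonneg x]
    have hprod : 1 ≤ (1 + x + x ^ 2 / 2) * (1 + -x + (-x) ^ 2 / 2) := by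
      nlinarith [sq_nonneg (x ^ 2)]
    have hle : Real.exp x * (1 + -x + (-x) ^ 2 / 2) ≤ 1 :=
      (mul_le_mul_of_nonneg_left hquad (Real.exp_pos x).le).trans hinv.le
    have h : Real.exp x ≤ 1 + x + x ^ 2 / 2 := le_of_mul_le_mul_right (hle.trans hprod) hpos
    nlinarith [sq_nonneg x]

lemma card_filter_univ_fin (n : ℕ) (p : ℕ → Prop) [DecidablePred p] :
    #{r : Fin n | p r} = #{r ∈ range n | p r} := by
  simp only [card_filter]
  exact Fin.sum_univ_eq_sum_range (fun r => if p r then 1 else 0) n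

section Median

variable {n : ℕ} (f : Fin n → ℝ)

lemma median_mem_Icc (hn : 0 < n) :
    median f ∈ Set.Icc (f (Tuple.sort f ⟨(n - 1) / 2, by omega⟩))
      (f (Tuple.sort f ⟨n / 2, by omega⟩)) := by
  have hmid : f (Tuple.sort f ⟨(n - 1) / 2, by omega⟩) ≤ f (Tuple.sort f ⟨n / 2, by omega⟩) :=
    Tuple.monotone_sort f (Fin.mk_le_mk.2 (by omega))
  rw [median, dif_pos hn]
  constructor <;> linarith

lemma le_two_mul_card_le_median : n ≤ 2 * #{r | f r ≤ median f} := by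
  rcases n.eq_zero_or_pos with rfl | hn
  · exact Nat.zero_le _
  have hcard : #(Iic (⟨(n - 1) / 2, by omega⟩ : Fin n)) ≤ #{r | f r ≤ median f} := by
    refine card_le_card_of_injOn (Tuple.sort f) (fun i hi => ?_) (Tuple.sort f).injective.injOn
    simpa using (Tuple.monotone_sort f (mem_Iic.1 hi)).trans (median_mem_Icc f hn).1
  rw [Fin.card_Iic, Fin.val_mk] at hcard
  omega

lemma le_two_mul_card_median_le : n ≤ 2 * #{r | median f ≤ f r} := by
  rcases n.eq_zero_or_pos with rfl | hn
  · exact Nat.zero_le _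
  have hcard : #(Ici (⟨n / 2, by omega⟩ : Fin n)) ≤ #{r | median f ≤ f r} := by
    refine card_le_card_of_injOn (Tuple.sort f) (fun i hi => ?_) (Tuple.sort f).injective.injOn
    simpa using (median_mem_Icc f hn).2.trans (Tuple.monotone_sort f (mem_Ici.1 hi))
  rw [Fin.card_Ici, Fin.val_mk] at hcard
  omega

end Median

section FiniteRange

variable {Ω ι : Type*} [MeasurableSpace Ω] [Fintype ι] [MeasurableSpace ι]
  [MeasurableSingletonClass ι] {P : Measure Ω} [IsProbabilityMeasure P] {X : Ω → ι}

lemma integral_comp_eq_sum (hX : Measurable X) (f : ι → ℝ) :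
    ∫ ω, f (X ω) ∂P = ∑ j, P.real (X ⁻¹' {j}) * f j := by
  have := Measure.isProbabilityMeasure_map (μ := P) hX.aemeasurable
  rw [← integral_map (f := f) hX.aemeasurable (by fun_prop),
    integral_fintype .of_finite]
  simp [map_measureReal_apply hX]

lemma integral_comp_le_add_mul_sum (hX : Measurable X) {f : ι → ℝ} (hf : 0 ≤ f) {a q : ℝ}
    (ha : 0 ≤ a) (hq : 0 ≤ q) (h : ∀ j, f j ≤ a ∨ P.real (X ⁻¹' {j}) ≤ q) :
    ∫ ω, f (X ω) ∂P ≤ a + q * ∑ j, f j := by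
  have hsum : ∑ j, P.real (X ⁻¹' {j}) = 1 := by
    simpa using (integral_comp_eq_sum (P := P) hX fun _ => 1).symm
  calc ∫ ω, f (X ω) ∂P = ∑ j, P.real (X ⁻¹' {j}) * f j := integral_comp_eq_sum hX f
    _ ≤ ∑ j, (P.real (X ⁻¹' {j}) * a + q * f j) := by
        refine sum_le_sum fun j _ => ?_
        have hp : 0 ≤ P.real (X ⁻¹' {j}) := measureReal_nonneg
        rcases h j with hj | hj
        · nlinarith [mul_nonneg hq (hf j)]
        · nlinarith [mul_nonneg hp ha, mul_le_mul_of_nonneg_right hj (hf j)]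
    _ = a + q * ∑ j, f j := by rw [sum_add_distrib, ← sum_mul, hsum, one_mul, mul_sum]

end FiniteRange

lemma exists_measurableSet_inter_fiber_eq {Ω β : Type*} {m : MeasurableSpace Ω}
    [MeasurableSpace β] {k : Ω → β} {A : Set Ω}
    (hA : MeasurableSet[m ⊔ MeasurableSpace.comap k inferInstance] A) (j : β) :
    ∃ A', MeasurableSet[m] A' ∧ A' ∩ k ⁻¹' {j} = A ∩ k ⁻¹' {j} := by
  let val : (k ⁻¹' {j} : Set Ω) → Ω := Subtype.val
  have hconst : k ∘ val = fun _ => j := funext fun ω => ω.2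
  have htrace : (m ⊔ MeasurableSpace.comap k inferInstance).comap val = m.comap val := by
    rw [MeasurableSpace.comap_sup, MeasurableSpace.comap_comp, hconst,
      MeasurableSpace.comap_const, sup_bot_eq]
  have hA' : MeasurableSet[m.comap val] (val ⁻¹' A) := htrace ▸ ⟨A, hA, rfl⟩
  obtain ⟨A', hA'm, hA'A⟩ := hA'
  refine ⟨A', hA'm, ?_⟩
  rw [Set.inter_comm A', Set.inter_comm A]
  exact Subtype.preimage_coe_eq_preimage_coe_iff.1 hA'A

lemma measurable_comp_of_dependsOn {Ω ι β γ : Type*} {m : MeasurableSpace Ω} [Countable β]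
    [MeasurableSpace β] [MeasurableSingletonClass β] [MeasurableSpace γ] [Nonempty γ]
    {φ : (ι → β) → γ} {S : Finset ι} (hφ : DependsOn φ (S : Set ι)) {k : ι → Ω → β}
    (hk : ∀ u ∈ S, Measurable (k u)) : Measurable fun ω => φ fun u => k u ω := by
  obtain ⟨g, rfl⟩ := dependsOn_iff_exists_comp.1 hφ
  exact (Measurable.of_discrete (f := g)).comp (measurable_pi_lambda _ fun u => hk u u.2)

section GroupProcess

/-- The number of the samples `1, …, s` that lie in group `r`, if sample `u` lies in group
`a u`. -/
def groupCount (a : ℕ → ℕ) (r s : ℕ) : ℕ := #{u ∈ Icc 1 s | a u = r}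

/-- The sum of the values `y u` of the samples `u = 1, …, s` that lie in group `r`. -/
def groupSum (a : ℕ → ℕ) (y : ℕ → ℝ) (r s : ℕ) : ℝ := ∑ u ∈ Icc 1 s with a u = r, y u

/-- The product over the groups `r < l` of `1 + g n x`, where `n` is the size of the group and `x`
the sum of its values after `s` samples. -/
noncomputable def groupProduct (g : ℕ → ℝ → ENNReal) (a : ℕ → ℕ) (y : ℕ → ℝ) (l s : ℕ) :
    ENNReal :=
  ∏ r ∈ range l, (1 + g (groupCount a r s) (groupSum a y r s))

variable (g : ℕ → ℝ → ENNReal) (a : ℕ → ℕ) (y : ℕ → ℝ) (l r s : ℕ)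

lemma groupCount_eq_sum : groupCount a r s = ∑ u ∈ Icc 1 s, if a u = r then 1 else 0 :=
  card_filter _ _

lemma groupSum_eq_sum : groupSum a y r s = ∑ u ∈ Icc 1 s, if a u = r then y u else 0 :=
  sum_filter _ _

lemma groupCount_succ :
    groupCount a r (s + 1) = groupCount a r s + if a (s + 1) = r then 1 else 0 := by
  simp only [groupCount_eq_sum, sum_Icc_succ_top (Nat.le_add_left 1 s)]

lemma groupSum_succ :
    groupSum a y r (s + 1) = groupSum a y r s + if a (s + 1) = r then y (s + 1) else 0 := by
  simp only [groupSum_eq_sum, sum_Icc_succ_top (Nat.le_add_left 1 s)]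

lemma groupProduct_zero : groupProduct g a y l 0 = (1 + g 0 0) ^ l := by
  simp [groupProduct, groupCount, groupSum]

lemma groupProduct_succ :
    groupProduct g a y l (s + 1) = ∏ r ∈ range l,
      (1 + g (groupCount a r s + if a (s + 1) = r then 1 else 0)
        (groupSum a y r s + if a (s + 1) = r then y (s + 1) else 0)) := by
  simp only [groupProduct, groupCount_succ, groupSum_succ]

lemma pow_le_groupProduct_sq {b : ENNReal}
    (h : l ≤ 2 * #{r ∈ range l | b ≤ g (groupCount a r s) (groupSum a y r s)}) :
    (1 + b) ^ l ≤ groupProduct g a y l s ^ 2 := by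
  set S := {r ∈ range l | b ≤ g (groupCount a r s) (groupSum a y r s)}
  have hprod : (1 + b) ^ #S ≤ groupProduct g a y l s :=
    calc (1 + b) ^ #S = ∏ _r ∈ S, (1 + b) := (prod_const _).symm
      _ ≤ ∏ r ∈ S, (1 + g (groupCount a r s) (groupSum a y r s)) :=
          prod_le_prod' fun r hr => add_le_add_right (mem_filter.1 hr).2 _
      _ ≤ groupProduct g a y l s :=
          prod_le_prod_of_subset_of_one_le' (filter_subset _ _) fun _ _ _ => le_self_add
  calc (1 + b) ^ l ≤ (1 + b) ^ (#S * 2) := pow_le_pow_right₀ le_self_add (by omega)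
    _ = ((1 + b) ^ #S) ^ 2 := pow_mul _ _ _
    _ ≤ groupProduct g a y l s ^ 2 := pow_le_pow_left₀ zero_le hprod 2

end GroupProcess

/-- A potential for sums of scores: if a sample of law `ν j` with score `d j` is added to `n`
samples with score sum `x`, then `g` does not increase in expectation. -/
structure IsSuperharmonic {ι α : Type*} [MeasurableSpace α] (ν : ι → Measure α)
    (d : ι → α → ℝ) (g : ℕ → ℝ → ENNReal) : Prop where
  measurable : ∀ n, Measurable (g n)
  lintegral_le : ∀ j n x, ∫⁻ z, g (n + 1) (x + d j z) ∂ν j ≤ g n x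

namespace IsSuperharmonic

variable {ι α : Type*} [MeasurableSpace α] {ν : ι → Measure α} {d : ι → α → ℝ}
  {g : ℕ → ℝ → ENNReal}

lemma lintegral_prod_update_le (hg : IsSuperharmonic ν d g) (j : ι) [IsProbabilityMeasure (ν j)]
    (hd : Measurable (d j)) (l a : ℕ) (n : ℕ → ℕ) (x : ℕ → ℝ) :
    ∫⁻ z, ∏ r ∈ range l, (1 + g (n r + if a = r then 1 else 0)
      (x r + if a = r then d j z else 0)) ∂ν j ≤ ∏ r ∈ range l, (1 + g (n r) (x r)) := by
  by_cases ha : a ∈ range l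
  · have hrest : ∀ z, ∏ r ∈ (range l).erase a, (1 + g (n r + if a = r then 1 else 0)
        (x r + if a = r then d j z else 0)) =
        ∏ r ∈ (range l).erase a, (1 + g (n r) (x r)) := fun z =>
      prod_congr rfl fun r hr => by simp [(ne_of_mem_erase hr).symm]
    have hm : Measurable fun z => 1 + g (n a + 1) (x a + d j z) :=
      ((hg.measurable _).comp (hd.const_add _)).const_add _
    simp_rw [← mul_prod_erase _ _ ha, hrest, if_true]
    rw [lintegral_mul_const _ hm, lintegral_add_left measurable_const, lintegral_const,
      measure_univ, mul_one]
    gcongr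
    exact hg.lintegral_le j (n a) (x a)
  · have hne : ∀ r ∈ range l, a ≠ r := fun r hr h => ha (h ▸ hr)
    have hconst : ∀ z, ∏ r ∈ range l, (1 + g (n r + if a = r then 1 else 0)
        (x r + if a = r then d j z else 0)) = ∏ r ∈ range l, (1 + g (n r) (x r)) := fun z =>
      prod_congr rfl fun r hr => by simp [hne r hr]
    simp [hconst]

end IsSuperharmonic

/-- Adaptive sampling: the index `k (s + 1)` is chosen on the basis of `𝓕 s`, and given `𝓕 s` the
sample `Z (s + 1)` has law `ν (k (s + 1))`. -/
structure IsAdaptiveSample {Ω ι α : Type*} [mΩ : MeasurableSpace Ω] [MeasurableSpace ι]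
    [MeasurableSpace α] (P : Measure Ω) (𝓕 : Filtration ℕ mΩ) (ν : Kernel ι α)
    (k : ℕ → Ω → ι) (Z : ℕ → Ω → α) : Prop where
  measurable_index : ∀ s, Measurable[𝓕 s] (k (s + 1))
  measurable_sample : ∀ s, Measurable[𝓕 (s + 1)] (Z (s + 1))
  measure_inter : ∀ s A S, MeasurableSet[𝓕 s] A → MeasurableSet S →
    P (A ∩ Z (s + 1) ⁻¹' S) = ∫⁻ ω in A, ν (k (s + 1) ω) S ∂P

namespace IsAdaptiveSample

variable {Ω ι α : Type*} [mΩ : MeasurableSpace Ω] [MeasurableSpace ι] [MeasurableSpace α]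
  {P : Measure Ω} {𝓕 : Filtration ℕ mΩ} {ν : Kernel ι α} {k : ℕ → Ω → ι} {Z : ℕ → Ω → α}

lemma lintegral_sample [IsProbabilityMeasure P] [IsMarkovKernel ν]
    (h : IsAdaptiveSample P 𝓕 ν k Z) (s : ℕ) {E : Type*} [MeasurableSpace E] {X : Ω → E}
    (hX : Measurable[𝓕 s] X) {f : E × α → ENNReal} (hf : Measurable f) :
    ∫⁻ ω, f (X ω, Z (s + 1) ω) ∂P = ∫⁻ ω, ∫⁻ z, f (X ω, z) ∂ν (k (s + 1) ω) ∂P := by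
  have hk : Measurable (k (s + 1)) := (h.measurable_index s).mono (𝓕.le s) le_rfl
  have hZ : Measurable (Z (s + 1)) := (h.measurable_sample s).mono (𝓕.le (s + 1)) le_rfl
  have hX' : Measurable X := hX.mono (𝓕.le s) le_rfl
  have hXid : Measurable (Prod.map X id : Ω × α → E × α) := hX'.prodMap measurable_id
  have hXZ := hX'.prodMk hZ
  have hlaw : P.map (fun ω => (X ω, Z (s + 1) ω)) =
      (P ⊗ₘ ν.comap (k (s + 1)) hk).map (Prod.map X id) := by
    have := Measure.isProbabilityMeasure_map (μ := P) hXZ.aemeasurable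
    refine Measure.ext_prod fun {U S} hU hS => ?_
    rw [Measure.map_apply hXZ (hU.prod hS), Measure.map_apply hXid (hU.prod hS),
      Set.mk_preimage_prod, Set.preimage_prod_map_prod, Set.preimage_id,
      Measure.compProd_apply_prod (hX' hU) hS, h.measure_inter s _ S (hX hU) hS]
    rfl
  rw [← lintegral_map hf hXZ, hlaw, lintegral_map hf hXid,
    Measure.lintegral_compProd (f := fun q => f (Prod.map X id q)) (hf.comp hXid)]
  rfl

variable {d : ι → α → ℝ} {g : ℕ → ℝ → ENNReal} {a : ℕ → Ω → ℕ}

lemma measurable_group (ha : ∀ s, Measurable[𝓕 s] (a (s + 1))) {u s : ℕ} (hu : u ∈ Icc 1 s) :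
    Measurable[𝓕 s] (a u) := by
  obtain ⟨hu1, hus⟩ := mem_Icc.1 hu
  obtain ⟨u, rfl⟩ := Nat.exists_eq_add_of_le' hu1
  exact (ha u).mono (𝓕.mono (by omega)) le_rfl

lemma measurable_groupCount (ha : ∀ s, Measurable[𝓕 s] (a (s + 1))) (r s : ℕ) :
    Measurable[𝓕 s] fun ω => groupCount (fun u => a u ω) r s := by
  simp_rw [groupCount_eq_sum]
  exact measurable_fun_sum _ fun u hu => Measurable.ite
    (measurable_group ha hu (measurableSet_singleton r)) measurable_const measurable_const

lemma measurable_score (h : IsAdaptiveSample P 𝓕 ν k Z) (hd : Measurable (Function.uncurry d))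
    (s : ℕ) : Measurable[𝓕 (s + 1)] fun ω => d (k (s + 1) ω) (Z (s + 1) ω) :=
  hd.comp (((h.measurable_index s).mono (𝓕.mono s.le_succ) le_rfl).prodMk (h.measurable_sample s))

lemma measurable_groupSum (h : IsAdaptiveSample P 𝓕 ν k Z) (hd : Measurable (Function.uncurry d))
    (ha : ∀ s, Measurable[𝓕 s] (a (s + 1))) (r s : ℕ) :
    Measurable[𝓕 s] fun ω => groupSum (fun u => a u ω) (fun u => d (k u ω) (Z u ω)) r s := by
  simp_rw [groupSum_eq_sum]
  refine measurable_fun_sum _ fun u hu => Measurable.ite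
    (measurable_group ha hu (measurableSet_singleton r)) ?_ measurable_const
  obtain ⟨hu1, hus⟩ := mem_Icc.1 hu
  obtain ⟨u, rfl⟩ := Nat.exists_eq_add_of_le' hu1
  exact (h.measurable_score hd u).mono (𝓕.mono hus) le_rfl

lemma measurable_groupProduct (h : IsAdaptiveSample P 𝓕 ν k Z)
    (hd : Measurable (Function.uncurry d)) (hg : ∀ n, Measurable (g n))
    (ha : ∀ s, Measurable[𝓕 s] (a (s + 1))) (l s : ℕ) :
    Measurable[𝓕 s] fun ω =>
      groupProduct g (fun u => a u ω) (fun u => d (k u ω) (Z u ω)) l s := by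
  have hg' : Measurable fun p : ℕ × ℝ => g p.1 p.2 := measurable_from_prod_countable_right hg
  exact measurable_fun_prod _ fun r _ => (hg'.comp
    ((measurable_groupCount ha r s).prodMk (h.measurable_groupSum hd ha r s))).const_add 1

variable [IsProbabilityMeasure P] [IsMarkovKernel ν]

lemma lintegral_groupProduct_succ_le (h : IsAdaptiveSample P 𝓕 ν k Z)
    (hd : Measurable (Function.uncurry d)) (hg : IsSuperharmonic ν d g)
    (ha : ∀ s, Measurable[𝓕 s] (a (s + 1))) (l s : ℕ) :
    ∫⁻ ω, groupProduct g (fun u => a u ω) (fun u => d (k u ω) (Z u ω)) l (s + 1) ∂P ≤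
      ∫⁻ ω, groupProduct g (fun u => a u ω) (fun u => d (k u ω) (Z u ω)) l s ∂P := by
  let X : Ω → ι × ℕ × (ℕ → ℕ) × (ℕ → ℝ) := fun ω =>
    (k (s + 1) ω, a (s + 1) ω, fun r => groupCount (fun u => a u ω) r s,
      fun r => groupSum (fun u => a u ω) (fun u => d (k u ω) (Z u ω)) r s)
  let f : (ι × ℕ × (ℕ → ℕ) × (ℕ → ℝ)) × α → ENNReal := fun ⟨⟨j, c, n, x⟩, z⟩ =>
    ∏ r ∈ range l, (1 + g (n r + if c = r then 1 else 0) (x r + if c = r then d j z else 0))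
  have hX : Measurable[𝓕 s] X :=
    (h.measurable_index s).prodMk ((ha s).prodMk
      ((@measurable_pi_lambda _ _ _ (𝓕 s) _ _ fun r => measurable_groupCount ha r s).prodMk
        (@measurable_pi_lambda _ _ _ (𝓕 s) _ _ fun r => h.measurable_groupSum hd ha r s)))
  have hg' : Measurable fun p : ℕ × ℝ => g p.1 p.2 :=
    measurable_from_prod_countable_right hg.measurable
  have hf : Measurable f := by
    refine measurable_fun_prod _ fun r _ => (hg'.comp (Measurable.prodMk ?_ ?_)).const_add 1
    all_goals
      have hc : MeasurableSet {q : (ι × ℕ × (ℕ → ℕ) × (ℕ → ℝ)) × α | q.1.2.1 = r} :=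
        measurable_fst.snd.fst (measurableSet_singleton r)
    · exact ((measurable_pi_apply r).comp measurable_fst.snd.snd.fst).add
        (Measurable.ite hc measurable_const measurable_const)
    · exact ((measurable_pi_apply r).comp measurable_fst.snd.snd.snd).add
        (Measurable.ite hc (hd.comp (measurable_fst.fst.prodMk measurable_snd)) measurable_const)
  simp_rw [groupProduct_succ]
  rw [show ∫⁻ ω, _ ∂P = ∫⁻ ω, f (X ω, Z (s + 1) ω) ∂P from rfl, h.lintegral_sample s hX hf]
  exact lintegral_mono fun ω =>
    hg.lintegral_prod_update_le (k (s + 1) ω) (hd.comp measurable_prodMk_left) l _ _ _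

lemma lintegral_groupProduct_le (h : IsAdaptiveSample P 𝓕 ν k Z)
    (hd : Measurable (Function.uncurry d)) (hg : IsSuperharmonic ν d g)
    (ha : ∀ s, Measurable[𝓕 s] (a (s + 1))) (l s : ℕ) :
    ∫⁻ ω, groupProduct g (fun u => a u ω) (fun u => d (k u ω) (Z u ω)) l s ∂P ≤
      (1 + g 0 0) ^ l := by
  induction s with
  | zero => simp [groupProduct_zero]
  | succ s ih => exact (h.lintegral_groupProduct_succ_le hd hg ha l s).trans ih

lemma measure_half_groups_le (h : IsAdaptiveSample P 𝓕 ν k Z)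
    (hd : Measurable (Function.uncurry d)) (hg : IsSuperharmonic ν d g)
    (ha : ∀ s, Measurable[𝓕 s] (a (s + 1))) {b c : ℝ} (hb : 0 ≤ b) (hc : 0 ≤ c)
    (hgc : g 0 0 ≤ ENNReal.ofReal c) (l s : ℕ) :
    P.real {ω | l ≤ 2 * #{r ∈ range l | ENNReal.ofReal b ≤ g (groupCount (fun u => a u ω) r s)
        (groupSum (fun u => a u ω) (fun u => d (k u ω) (Z u ω)) r s)}} ≤
      ((1 + c) / √(1 + b)) ^ l := by
  set E := {ω | l ≤ 2 * #{r ∈ range l | ENNReal.ofReal b ≤ g (groupCount (fun u => a u ω) r s)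
    (groupSum (fun u => a u ω) (fun u => d (k u ω) (Z u ω)) r s)}}
  set G : Ω → ENNReal := fun ω =>
    groupProduct g (fun u => a u ω) (fun u => d (k u ω) (Z u ω)) l s
  have hlarge : E ⊆ {ω | ENNReal.ofReal (√(1 + b) ^ l) ≤ G ω} := fun ω hω => by
    refine (ENNReal.pow_le_pow_left_iff two_ne_zero).1 ?_
    rw [← ENNReal.ofReal_pow (by positivity), pow_right_comm, Real.sq_sqrt (by positivity),
      ENNReal.ofReal_pow (by positivity), ENNReal.ofReal_add zero_le_one hb, ENNReal.ofReal_one]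
    exact pow_le_groupProduct_sq g _ _ l s hω
  have hG : Measurable G :=
    (h.measurable_groupProduct hd hg.measurable ha l s).mono (𝓕.le s) le_rfl
  have hmarkov : ENNReal.ofReal (√(1 + b) ^ l) * P E ≤ ENNReal.ofReal ((1 + c) ^ l) :=
    calc _ ≤ ENNReal.ofReal (√(1 + b) ^ l) * P {ω | ENNReal.ofReal (√(1 + b) ^ l) ≤ G ω} := by
          gcongr
      _ ≤ ∫⁻ ω, G ω ∂P := mul_meas_ge_le_lintegral₀ hG.aemeasurable _
      _ ≤ (1 + g 0 0) ^ l := h.lintegral_groupProduct_le hd hg ha l s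
      _ ≤ ENNReal.ofReal ((1 + c) ^ l) := by
          rw [ENNReal.ofReal_pow (by positivity), ENNReal.ofReal_add zero_le_one hc,
            ENNReal.ofReal_one]
          gcongr
  rw [div_pow, le_div_iff₀' (by positivity)]
  simpa [ENNReal.toReal_mul, measureReal_def, hc, add_nonneg] using
    ENNReal.toReal_mono ENNReal.ofReal_ne_top hmarkov

end IsAdaptiveSample

/-- A square integrable score function with mean zero and variance at most one. -/
structure IsNormalizedScore {α : Type*} [MeasurableSpace α] (ν : Measure α) (d : α → ℝ) :
    Prop where
  memLp : MemLp d 2 ν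
  integral_eq_zero : ∫ z, d z ∂ν = 0
  integral_sq_le_one : ∫ z, d z ^ 2 ∂ν ≤ 1

namespace IsNormalizedScore

variable {α : Type*} [MeasurableSpace α] {ν : Measure α} {d : α → ℝ}

lemma neg (h : IsNormalizedScore ν d) : IsNormalizedScore ν fun z => -d z where
  memLp := h.memLp.neg
  integral_eq_zero := by rw [integral_neg, h.integral_eq_zero, neg_zero]
  integral_sq_le_one := by simpa only [neg_sq] using h.integral_sq_le_one

variable [IsProbabilityMeasure ν]

lemma lintegral_exp_le (h : IsNormalizedScore ν d) (hd : ∀ᵐ z ∂ν, d z ≤ 1) {lam : ℝ}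
    (h0 : 0 ≤ lam) (h1 : lam ≤ 1 / 2) :
    ∫⁻ z, ENNReal.ofReal (Real.exp (lam * d z)) ∂ν ≤
      ENNReal.ofReal (Real.exp (5 / 8 * lam ^ 2)) := by
  have hi : Integrable (fun z => lam * d z) ν := (h.memLp.integrable one_le_two).const_mul _
  have hi1 : Integrable (fun z => 1 + lam * d z) ν := (integrable_const _).add hi
  have hi2 : Integrable (fun z => 5 / 8 * lam ^ 2 * d z ^ 2) ν := h.memLp.integrable_sq.const_mul _
  calc ∫⁻ z, ENNReal.ofReal (Real.exp (lam * d z)) ∂ν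
      ≤ ∫⁻ z, ENNReal.ofReal (1 + lam * d z + 5 / 8 * lam ^ 2 * d z ^ 2) ∂ν := by
        refine lintegral_mono_ae ?_
        filter_upwards [hd] with z hz
        refine ENNReal.ofReal_le_ofReal ((exp_le_one_add_add_sq (by nlinarith)).trans_eq ?_)
        ring
    _ = ENNReal.ofReal (∫ z, (1 + lam * d z + 5 / 8 * lam ^ 2 * d z ^ 2) ∂ν) := by
        refine (ofReal_integral_eq_lintegral_ofReal (hi1.add hi2) (.of_forall fun z => ?_)).symm
        simp only [Pi.zero_apply, Pi.add_apply]
        nlinarith [sq_nonneg (lam * d z + 1)]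
    _ = ENNReal.ofReal (1 + 5 / 8 * lam ^ 2 * ∫ z, d z ^ 2 ∂ν) := by
        rw [integral_add hi1 hi2, integral_add (integrable_const _) hi, integral_const_mul,
          integral_const_mul, h.integral_eq_zero]
        simp
    _ ≤ ENNReal.ofReal (Real.exp (5 / 8 * lam ^ 2)) := by
        refine ENNReal.ofReal_le_ofReal ?_
        nlinarith [Real.add_one_le_exp (5 / 8 * lam ^ 2), sq_nonneg lam, h.integral_sq_le_one]

lemma integrable_add_sq (h : IsNormalizedScore ν d) (x : ℝ) :
    Integrable (fun z => (x + d z) ^ 2) ν :=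
  ((memLp_const x).add h.memLp).integrable_sq

lemma integral_add_sq_le (h : IsNormalizedScore ν d) (x : ℝ) :
    ∫ z, (x + d z) ^ 2 ∂ν ≤ x ^ 2 + 1 := by
  have hi : Integrable (fun z => 2 * x * d z) ν := (h.memLp.integrable one_le_two).const_mul _
  have hi1 : Integrable (fun z => x ^ 2 + 2 * x * d z) ν := (integrable_const _).add hi
  calc ∫ z, (x + d z) ^ 2 ∂ν = ∫ z, (x ^ 2 + 2 * x * d z + d z ^ 2) ∂ν := by
        simp_rw [add_sq]
    _ = x ^ 2 + ∫ z, d z ^ 2 ∂ν := by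
        rw [integral_add hi1 h.memLp.integrable_sq, integral_add (integrable_const _) hi,
          integral_const_mul, h.integral_eq_zero]
        simp
    _ ≤ x ^ 2 + 1 := by linarith [h.integral_sq_le_one]

end IsNormalizedScore

section Potentials

/-- The exponential potential, which controls the tail of sums of scores that are bounded above. -/
noncomputable def expPotential (lam : ℝ) (n : ℕ) (x : ℝ) : ENNReal :=
  ENNReal.ofReal (1 / 2 * Real.exp (lam * x - 5 / 8 * lam ^ 2 * n))

/-- The quadratic potential, which controls the tail of sums of unbounded scores. -/
noncomputable def quadPotential (m : ℝ) (n : ℕ) (x : ℝ) : ENNReal :=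
  ENNReal.ofReal (m / 2 * (x ^ 2 / (n + m) ^ 2 + 1 / (n + m)))

variable {ι α : Type*} [MeasurableSpace α] {ν : ι → Measure α} [∀ j, IsProbabilityMeasure (ν j)]
  {d : ι → α → ℝ}

lemma isSuperharmonic_expPotential (h : ∀ j, IsNormalizedScore (ν j) (d j))
    (hd : ∀ j, ∀ᵐ z ∂ν j, d j z ≤ 1) {lam : ℝ} (h0 : 0 ≤ lam) (h1 : lam ≤ 1 / 2) :
    IsSuperharmonic ν d (expPotential lam) where
  measurable n := by unfold expPotential; fun_prop
  lintegral_le j n x := by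
    have hsplit : ∀ z, expPotential lam (n + 1) (x + d j z) =
        expPotential lam n x * ENNReal.ofReal (Real.exp (-(5 / 8 * lam ^ 2))) *
          ENNReal.ofReal (Real.exp (lam * d j z)) := fun z => by
      simp only [expPotential]
      rw [← ENNReal.ofReal_mul (by positivity), ← ENNReal.ofReal_mul (by positivity),
        show lam * (x + d j z) - 5 / 8 * lam ^ 2 * (n + 1 : ℕ) =
          lam * x - 5 / 8 * lam ^ 2 * n + -(5 / 8 * lam ^ 2) + lam * d j z by push_cast; ring,
        Real.exp_add, Real.exp_add, ← mul_assoc, ← mul_assoc]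
    have hfin : expPotential lam n x * ENNReal.ofReal (Real.exp (-(5 / 8 * lam ^ 2))) ≠ ⊤ :=
      ENNReal.mul_ne_top ENNReal.ofReal_ne_top ENNReal.ofReal_ne_top
    calc ∫⁻ z, expPotential lam (n + 1) (x + d j z) ∂ν j
        = expPotential lam n x * ENNReal.ofReal (Real.exp (-(5 / 8 * lam ^ 2))) *
            ∫⁻ z, ENNReal.ofReal (Real.exp (lam * d j z)) ∂ν j := by
          simp_rw [hsplit, lintegral_const_mul' _ _ hfin]
      _ ≤ expPotential lam n x * ENNReal.ofReal (Real.exp (-(5 / 8 * lam ^ 2))) *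
            ENNReal.ofReal (Real.exp (5 / 8 * lam ^ 2)) := by
          gcongr
          exact (h j).lintegral_exp_le (hd j) h0 h1
      _ = expPotential lam n x := by
          rw [mul_assoc, ← ENNReal.ofReal_mul (by positivity), ← Real.exp_add, neg_add_cancel,
            Real.exp_zero, ENNReal.ofReal_one, mul_one]

lemma isSuperharmonic_quadPotential (h : ∀ j, IsNormalizedScore (ν j) (d j)) {m : ℝ}
    (hm : 0 < m) : IsSuperharmonic ν d (quadPotential m) where
  measurable n := by unfold quadPotential; fun_prop
  lintegral_le j n x := by
    have hi : Integrable (fun z => (x + d j z) ^ 2 / ((n + 1 : ℕ) + m) ^ 2) (ν j) :=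
      ((h j).integrable_add_sq x).div_const _
    have hi' : Integrable (fun z => m / 2 *
        ((x + d j z) ^ 2 / ((n + 1 : ℕ) + m) ^ 2 + 1 / ((n + 1 : ℕ) + m))) (ν j) :=
      (hi.add (integrable_const _)).const_mul _
    have hs : (0 : ℝ) < n + m := by positivity
    simp only [quadPotential]
    rw [← ofReal_integral_eq_lintegral_ofReal hi' (.of_forall fun z => by positivity)]
    refine ENNReal.ofReal_le_ofReal ?_
    rw [integral_const_mul, integral_add hi (integrable_const _), integral_div, integral_const,
      probReal_univ, one_smul, show ((n + 1 : ℕ) : ℝ) + m = (n + m) + 1 by push_cast; ring]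
    refine mul_le_mul_of_nonneg_left ?_ (by positivity)
    generalize (n : ℝ) + m = s at hs
    calc (∫ z, (x + d j z) ^ 2 ∂ν j) / (s + 1) ^ 2 + 1 / (s + 1)
        ≤ (x ^ 2 + 1) / (s + 1) ^ 2 + 1 / (s + 1) := by
          gcongr
          exact (h j).integral_add_sq_le x
      _ = x ^ 2 / (s + 1) ^ 2 + (1 / (s + 1) ^ 2 + 1 / (s + 1)) := by ring
      _ ≤ x ^ 2 / s ^ 2 + 1 / s := by
          gcongr
          · linarith
          · rw [div_add_div _ _ (by positivity) (by positivity),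
              div_le_div_iff₀ (by positivity) hs]
            nlinarith [pow_pos hs 2, pow_pos hs 3]

lemma two_le_expPotential {ε : ℝ} (hε : 0 ≤ ε) {m n : ℕ} (hm : 15 / 4 ≤ m * ε ^ 2) (hmn : m ≤ n)
    {x : ℝ} (hx : n * ε ≤ x) : 2 ≤ expPotential (4 / 5 * ε) n x := by
  have hn : (m : ℝ) * ε ^ 2 ≤ n * ε ^ 2 := by gcongr
  have hexponent : 3 / 2 ≤ 4 / 5 * ε * x - 5 / 8 * (4 / 5 * ε) ^ 2 * n := by
    nlinarith [mul_le_mul_of_nonneg_left hx hε]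
  have hexp : 4 ≤ Real.exp (3 / 2) := by
    have hsum := Real.sum_le_exp_of_nonneg (x := 3 / 2) (by norm_num) 5
    norm_num [sum_range_succ, Nat.factorial] at hsum
    linarith
  rw [expPotential, ← ENNReal.ofReal_ofNat 2]
  exact ENNReal.ofReal_le_ofReal (by linarith [Real.exp_le_exp.2 hexponent])

lemma two_le_quadPotential {ε : ℝ} (hε : 0 ≤ ε) {m n : ℕ} (hm : 16 / 9 ≤ m * ε ^ 2) (hmn : m ≤ n)
    {x : ℝ} (hx : 3 * (n * ε) ≤ x) : 2 ≤ quadPotential m n x := by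
  have hm0 : (0 : ℝ) < m := by
    by_contra! h
    nlinarith [sq_nonneg ε]
  have hmn' : (m : ℝ) ≤ n := mod_cast hmn
  have hratio : 9 / 4 * ε ^ 2 ≤ x ^ 2 / (n + m) ^ 2 := by
    rw [le_div_iff₀ (by positivity)]
    calc 9 / 4 * ε ^ 2 * (n + m) ^ 2 ≤ 9 / 4 * ε ^ 2 * (n + n) ^ 2 := by gcongr
      _ = (3 * (n * ε)) ^ 2 := by ring
      _ ≤ x ^ 2 := by gcongr
  have hpos : (0 : ℝ) ≤ 1 / (n + m) := by positivity
  rw [quadPotential, ← ENNReal.ofReal_ofNat 2]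
  refine ENNReal.ofReal_le_ofReal ?_
  nlinarith [mul_le_mul_of_nonneg_left hratio hm0.le]

end Potentials

namespace IsAdaptiveSample

variable {Ω ι α : Type*} [mΩ : MeasurableSpace Ω] [MeasurableSpace ι] [MeasurableSpace α]
  {P : Measure Ω} [IsProbabilityMeasure P] {𝓕 : Filtration ℕ mΩ} {ν : Kernel ι α}
  [IsMarkovKernel ν] {k : ℕ → Ω → ι} {Z : ℕ → Ω → α} {d : ι → α → ℝ} {a : ℕ → Ω → ℕ}

lemma measure_half_groups_le_of_two_le (h : IsAdaptiveSample P 𝓕 ν k Z)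
    (hd : Measurable (Function.uncurry d)) {g : ℕ → ℝ → ENNReal} (hg : IsSuperharmonic ν d g)
    (ha : ∀ s, Measurable[𝓕 s] (a (s + 1))) (hg0 : g 0 0 ≤ ENNReal.ofReal (1 / 2))
    {θ : ℕ → ℝ} {m l s : ℕ} (hgθ : ∀ n x, m ≤ n → θ n ≤ x → 2 ≤ g n x)
    (hm : ∀ ω, ∀ r < l, m ≤ groupCount (fun u => a u ω) r s) :
    P.real {ω | l ≤ 2 * #{r ∈ range l | θ (groupCount (fun u => a u ω) r s) ≤
      groupSum (fun u => a u ω) (fun u => d (k u ω) (Z u ω)) r s}} ≤ (√3 / 2) ^ l := by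
  have hbase : (1 + 1 / 2) / √(1 + 2) = √3 / 2 := by
    rw [show (1 : ℝ) + 2 = 3 by norm_num, div_eq_div_iff (by positivity) two_ne_zero,
      Real.mul_self_sqrt (by norm_num)]
    norm_num
  rw [← hbase]
  refine le_trans (measureReal_mono fun ω hω => ?_)
    (h.measure_half_groups_le hd hg ha zero_le_two (by norm_num) hg0 l s)
  refine le_trans (α := ℕ) hω (Nat.mul_le_mul_left 2 (card_le_card fun r hr => ?_))
  obtain ⟨hrl, hθ⟩ := mem_filter.1 hr
  refine mem_filter.2 ⟨hrl, ?_⟩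
  rw [ENNReal.ofReal_ofNat]
  exact hgθ _ _ (hm ω r (mem_range.1 hrl)) hθ

lemma measure_half_groupSum_ge_le_of_le_one (h : IsAdaptiveSample P 𝓕 ν k Z)
    (hd : Measurable (Function.uncurry d)) (hν : ∀ j, IsNormalizedScore (ν j) (d j))
    (hd1 : ∀ j, ∀ᵐ z ∂ν j, d j z ≤ 1) (ha : ∀ s, Measurable[𝓕 s] (a (s + 1))) {ε : ℝ} {m l s : ℕ}
    (hε : 0 ≤ ε) (hε' : ε ≤ 5 / 8) (hmε : 15 / 4 ≤ m * ε ^ 2)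
    (hm : ∀ ω, ∀ r < l, m ≤ groupCount (fun u => a u ω) r s) :
    P.real {ω | l ≤ 2 * #{r ∈ range l | groupCount (fun u => a u ω) r s * ε ≤
      groupSum (fun u => a u ω) (fun u => d (k u ω) (Z u ω)) r s}} ≤ (√3 / 2) ^ l :=
  h.measure_half_groups_le_of_two_le hd
    (isSuperharmonic_expPotential hν hd1 (lam := 4 / 5 * ε) (by positivity) (by linarith)) ha
    (by simp [expPotential]) (θ := fun n => n * ε)
    (fun _ _ hmn hx => two_le_expPotential hε hmε hmn hx) hm

lemma measure_half_groupSum_ge_le (h : IsAdaptiveSample P 𝓕 ν k Z)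
    (hd : Measurable (Function.uncurry d)) (hν : ∀ j, IsNormalizedScore (ν j) (d j))
    (ha : ∀ s, Measurable[𝓕 s] (a (s + 1))) {ε : ℝ} {m l s : ℕ}
    (hε : 0 ≤ ε) (hmε : 16 / 9 ≤ m * ε ^ 2)
    (hm : ∀ ω, ∀ r < l, m ≤ groupCount (fun u => a u ω) r s) :
    P.real {ω | l ≤ 2 * #{r ∈ range l | 3 * (groupCount (fun u => a u ω) r s * ε) ≤
      groupSum (fun u => a u ω) (fun u => d (k u ω) (Z u ω)) r s}} ≤ (√3 / 2) ^ l := by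
  have hm0 : (0 : ℝ) < m := by
    by_contra! hneg
    nlinarith [sq_nonneg ε]
  have hg0 : quadPotential m 0 0 = ENNReal.ofReal (1 / 2) := by
    rw [quadPotential, Nat.cast_zero, zero_add, zero_pow two_ne_zero, zero_div, zero_add]
    congr 1
    field_simp
  exact h.measure_half_groups_le_of_two_le hd (isSuperharmonic_quadPotential hν hm0) ha hg0.le
    (θ := fun n => 3 * (n * ε))
    (fun _ _ hmn hx => two_le_quadPotential hε hmε hmn hx) hm

end IsAdaptiveSample

namespace ExpertBandit

variable {𝒳 : Type*} [MeasurableSpace 𝒳] {K N : ℕ} (B : ExpertBandit 𝒳 K N)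

attribute [instance] isProbabilityMeasure isMarkovKernel

lemma measurable_observation :
    Measurable fun z : (𝒳 × (Fin K → ℝ)) × Fin K => (z.1.1, z.2, z.1.2 z.2) :=
  measurable_fst.fst.prodMk (measurable_snd.prodMk
    (measurable_from_prod_countable_left fun v => (measurable_pi_apply v).comp measurable_snd))

instance (j : Fin N) : IsProbabilityMeasure (B.law j) :=
  Measure.isProbabilityMeasure_map measurable_observation.aemeasurable

lemma lintegral_law (j : Fin N) {f : 𝒳 × Fin K × ℝ → ENNReal} (hf : Measurable f) :
    ∫⁻ z, f z ∂B.law j =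
      ∫⁻ w, ∑ v, f (w.1, v, w.2 v) * ENNReal.ofReal (B.prob j w.1 v) ∂B.nature := by
  rw [law, lintegral_map hf measurable_observation]
  refine (Measure.lintegral_compProd (hf.comp measurable_observation)).trans ?_
  simp [lintegral_fintype, prob]

lemma prob_nonneg (j : Fin N) (x : 𝒳) (v : Fin K) : 0 ≤ B.prob j x v := measureReal_nonneg

lemma measurable_prob (j : Fin N) (v : Fin K) : Measurable fun x => B.prob j x v :=
  ((B.expert j).measurable_coe (measurableSet_singleton v)).ennreal_toReal

lemma ratio_nonneg (i j : Fin N) (x : 𝒳) (v : Fin K) : 0 ≤ B.ratio i j x v :=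
  div_nonneg (B.prob_nonneg i x v) (B.prob_nonneg j x v)

lemma measurable_ratio (i j : Fin N) :
    Measurable fun z : 𝒳 × Fin K × ℝ => B.ratio i j z.1 z.2.1 := by
  have h : Measurable fun p : 𝒳 × Fin K => B.ratio i j p.1 p.2 :=
    measurable_from_prod_countable_left fun v =>
      (B.measurable_prob i v).div (B.measurable_prob j v)
  exact h.comp (measurable_fst.prodMk measurable_snd.fst)

lemma ae_law_reward_mem (j : Fin N) : ∀ᵐ z ∂B.law j, z.2.2 ∈ Set.Icc (0 : ℝ) 1 := by
  have hm : MeasurableSet {z : 𝒳 × Fin K × ℝ | z.2.2 ∈ Set.Icc (0 : ℝ) 1} :=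
    measurable_snd.snd measurableSet_Icc
  rw [law, ae_map_iff measurable_observation.aemeasurable hm]
  refine Measure.ae_compProd_of_ae_ae (measurable_observation hm) ?_
  filter_upwards [B.reward_mem] with w hw
  exact .of_forall hw

variable {B}

lemma law_eq_withDensity {i j : Fin N}
    (hac : ∀ᵐ w ∂B.nature, ∀ v, B.prob j w.1 v = 0 → B.prob i w.1 v = 0) :
    B.law i = (B.law j).withDensity fun z => ENNReal.ofReal (B.ratio i j z.1 z.2.1) := by
  refine Measure.ext_of_lintegral _ fun f hf => ?_
  have hr := (B.measurable_ratio i j).ennreal_ofReal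
  rw [lintegral_withDensity_eq_lintegral_mul _ hr hf, B.lintegral_law i hf,
    B.lintegral_law j (hr.mul hf)]
  refine lintegral_congr_ae ?_
  filter_upwards [hac] with w hw
  refine sum_congr rfl fun v _ => ?_
  have hprob : B.prob i w.1 v = B.ratio i j w.1 v * B.prob j w.1 v :=
    (div_mul_cancel_of_imp (hw v)).symm
  rw [hprob, ENNReal.ofReal_mul (B.ratio_nonneg _ _ _ _), Pi.mul_apply, ← mul_assoc,
    mul_comm (f _)]

lemma integral_mul_ratio {i j : Fin N}
    (hac : ∀ᵐ w ∂B.nature, ∀ v, B.prob j w.1 v = 0 → B.prob i w.1 v = 0)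
    (f : 𝒳 × Fin K × ℝ → ℝ) :
    ∫ z, f z * B.ratio i j z.1 z.2.1 ∂B.law j = ∫ z, f z ∂B.law i := by
  rw [law_eq_withDensity hac, integral_withDensity_eq_integral_toReal_smul
    (B.measurable_ratio i j).ennreal_ofReal (by simp)]
  simp [ENNReal.toReal_ofReal (B.ratio_nonneg _ _ _ _), mul_comm]

lemma memLp_ratio {i j : Fin N}
    (hint : Integrable (fun z => B.ratio i j z.1 z.2.1 ^ 2 - 1) (B.law j)) :
    MemLp (fun z => B.ratio i j z.1 z.2.1) 2 (B.law j) := by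
  rw [memLp_two_iff_integrable_sq (B.measurable_ratio i j).aestronglyMeasurable]
  simpa only [Pi.add_def, sub_add_cancel] using hint.add (integrable_const (1 : ℝ))

lemma one_add_condFDiv {i j : Fin N}
    (hint : Integrable (fun z => B.ratio i j z.1 z.2.1 ^ 2 - 1) (B.law j)) :
    1 + B.condFDiv (fun x => x ^ 2 - 1) i j = ∫ z, B.ratio i j z.1 z.2.1 ^ 2 ∂B.law j := by
  rw [condFDiv, integral_sub (memLp_ratio hint).integrable_sq (integrable_const _)]
  simp

namespace ChiSquareFinite

variable (hB : B.ChiSquareFinite) (i j : Fin N)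
include hB

lemma one_le_integral_ratio_sq : 1 ≤ ∫ z, B.ratio i j z.1 z.2.1 ^ 2 ∂B.law j := by
  have hmean : ∫ z, B.ratio i j z.1 z.2.1 ∂B.law j = 1 := by
    simpa using integral_mul_ratio (hB i j).1 fun _ => 1
  have hvar := variance_eq_sub (memLp_ratio (hB i j).2)
  simp only [hmean, Pi.pow_apply] at hvar
  linarith [variance_nonneg (fun z : 𝒳 × Fin K × ℝ => B.ratio i j z.1 z.2.1) (B.law j)]

lemma sigma_sq : B.sigma i j ^ 2 = ∫ z, B.ratio i j z.1 z.2.1 ^ 2 ∂B.law j := by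
  rw [sigma, one_add_condFDiv (hB i j).2, Real.sq_sqrt]
  linarith [hB.one_le_integral_ratio_sq i j]

lemma one_le_sigma : 1 ≤ B.sigma i j := by
  rw [sigma, Real.one_le_sqrt, one_add_condFDiv (hB i j).2]
  exact hB.one_le_integral_ratio_sq i j

lemma sigma_pos : 0 < B.sigma i j := zero_lt_one.trans_le (hB.one_le_sigma i j)

end ChiSquareFinite

variable (B)

lemma sigma_le_sigmaMax (i j : Fin N) : B.sigma i j ≤ B.sigmaMax :=
  le_ciSup (f := fun p : Fin N × Fin N => B.sigma p.1 p.2) (Set.finite_range _).bddAbove (i, j)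

lemma mean_mem_Icc (i : Fin N) : B.mean i ∈ Set.Icc (0 : ℝ) 1 := by
  have h := B.ae_law_reward_mem i
  have hi : Integrable (fun z : 𝒳 × Fin K × ℝ => z.2.2) (B.law i) :=
    .of_mem_Icc 0 1 measurable_snd.snd.aemeasurable h
  refine ⟨integral_nonneg_of_ae (h.mono fun z hz => hz.1), ?_⟩
  simpa [mean] using integral_mono_ae hi (integrable_const (1 : ℝ)) (h.mono fun z hz => hz.2)

/-- The centred and normalized importance sampling score: an observation `z` made under expert `j`
is used to estimate the mean of expert `i`. -/
noncomputable def score (i j : Fin N) (z : 𝒳 × Fin K × ℝ) : ℝ :=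
  (z.2.2 * B.ratio i j z.1 z.2.1 - B.mean i) / B.sigma i j

lemma measurable_reward_mul_ratio (i j : Fin N) :
    Measurable fun z : 𝒳 × Fin K × ℝ => z.2.2 * B.ratio i j z.1 z.2.1 :=
  measurable_snd.snd.mul (B.measurable_ratio i j)

lemma measurable_score (i : Fin N) : Measurable (Function.uncurry (B.score i)) :=
  measurable_from_prod_countable_right fun j =>
    ((B.measurable_reward_mul_ratio i j).sub_const (B.mean i)).div_const (B.sigma i j)

lemma reward_mul_ratio_mem_Icc {i j : Fin N} {z : 𝒳 × Fin K × ℝ}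
    (hz : z.2.2 ∈ Set.Icc (0 : ℝ) 1) :
    z.2.2 * B.ratio i j z.1 z.2.1 ∈ Set.Icc 0 (B.ratio i j z.1 z.2.1) :=
  ⟨mul_nonneg hz.1 (B.ratio_nonneg _ _ _ _),
    mul_le_of_le_one_left (B.ratio_nonneg _ _ _ _) hz.2⟩

variable {B}

lemma memLp_reward_mul_ratio {i j : Fin N}
    (hint : Integrable (fun z => B.ratio i j z.1 z.2.1 ^ 2 - 1) (B.law j)) :
    MemLp (fun z => z.2.2 * B.ratio i j z.1 z.2.1) 2 (B.law j) := by
  refine (memLp_ratio hint).mono (B.measurable_reward_mul_ratio i j).aestronglyMeasurable ?_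
  filter_upwards [B.ae_law_reward_mem j] with z hz
  have hmem := B.reward_mul_ratio_mem_Icc (i := i) (j := j) hz
  rw [Real.norm_of_nonneg hmem.1, Real.norm_of_nonneg (B.ratio_nonneg _ _ _ _)]
  exact hmem.2

namespace ChiSquareFinite

variable (hB : B.ChiSquareFinite) (i j : Fin N)
include hB

lemma variance_reward_mul_ratio_le :
    Var[fun z => z.2.2 * B.ratio i j z.1 z.2.1; B.law j] ≤ B.sigma i j ^ 2 := by
  rw [hB.sigma_sq]
  refine (variance_le_expectation_sq
    (B.measurable_reward_mul_ratio i j).aestronglyMeasurable).trans ?_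
  refine integral_mono_ae (memLp_reward_mul_ratio (hB i j).2).integrable_sq
    (memLp_ratio (hB i j).2).integrable_sq ?_
  filter_upwards [B.ae_law_reward_mem j] with z hz
  have hmem := B.reward_mul_ratio_mem_Icc (i := i) (j := j) hz
  exact pow_le_pow_left₀ hmem.1 hmem.2 2

lemma isNormalizedScore : IsNormalizedScore (B.law j) (B.score i j) := by
  have hL := memLp_reward_mul_ratio (hB i j).2
  have hmean : ∫ z, z.2.2 * B.ratio i j z.1 z.2.1 ∂B.law j = B.mean i :=
    integral_mul_ratio (hB i j).1 fun z => z.2.2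
  have hvar := hB.variance_reward_mul_ratio_le i j
  rw [variance_eq_integral hL.aemeasurable, hmean] at hvar
  refine ⟨?_, ?_, ?_⟩
  · exact (memLp_congr_ae (.of_forall fun z => div_eq_inv_mul _ _)).2
      ((hL.sub (memLp_const (B.mean i))).const_mul (B.sigma i j)⁻¹)
  · simp only [score]
    rw [integral_div, integral_sub (hL.integrable one_le_two) (integrable_const _), hmean]
    simp
  · simp only [score, div_pow]
    rw [integral_div]
    exact div_le_one_of_le₀ hvar (sq_nonneg _)

lemma ae_neg_score_le_one : ∀ᵐ z ∂B.law j, -B.score i j z ≤ 1 := by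
  filter_upwards [B.ae_law_reward_mem j] with z hz
  have hnonneg := (B.reward_mul_ratio_mem_Icc (i := i) (j := j) hz).1
  rw [score, ← neg_div, div_le_one (hB.sigma_pos i j)]
  linarith [(B.mean_mem_Icc i).2, hB.one_le_sigma i j]

end ChiSquareFinite

end ExpertBandit

namespace Division

variable {N : ℕ} (D : Division N) (t : ℕ) (h : ℕ → Fin N) (r : ℕ)

lemma sum_samples {M : Type*} [AddCommMonoid M] (φ : Fin N → ℕ → M) :
    ∑ j, ∑ s ∈ D.samples t h r j, φ j s = ∑ u ∈ Icc 1 t with D.assign t h u = r, φ (h u) u := by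
  simp only [samples, sum_filter]
  rw [sum_comm]
  refine sum_congr rfl fun u _ => ?_
  simp [ite_and]

lemma size_eq_groupCount : D.size t h r = groupCount (D.assign t h) r t := by
  simpa only [size, groupCount, card_eq_sum_ones] using D.sum_samples t h r fun _ _ => 1

end Division

/-- The confidence width for samples of unit variance; the width of expert `k` at time `t` is
`radius t / W_k(t)`. -/
noncomputable def radius (t : ℕ) : ℝ := √(64 * Real.log (1 / delta t) / t)

lemma radius_nonneg (t : ℕ) : 0 ≤ radius t := Real.sqrt_nonneg _

namespace ExpertBandit

variable {𝒳 : Type*} [MeasurableSpace 𝒳] {K N : ℕ} {B : ExpertBandit 𝒳 K N} {D : Division N}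
  {t : ℕ} {h : ℕ → Fin N} {r : ℕ}

lemma groupWeight_eq_groupSum (i : Fin N) :
    B.groupWeight D t h i r = groupSum (D.assign t h) (fun u => 1 / B.sigma i (h u)) r t := by
  rw [groupSum, ← D.sum_samples t h r fun j _ => 1 / B.sigma i j]
  simp [groupWeight, div_eq_mul_inv]

lemma groupSum_score {z : ℕ → 𝒳 × Fin K × ℝ} {i : Fin N} (hW : B.groupWeight D t h i r ≠ 0) :
    groupSum (D.assign t h) (fun u => B.score i (h u) (z u)) r t =
      B.groupWeight D t h i r * (B.groupMean D t h z i r - B.mean i) := by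
  rw [groupMean, D.sum_samples t h r
    fun j s => 1 / B.sigma i j * (z s).2.2 * B.ratio i j (z s).1 (z s).2.1, mul_sub, ← mul_assoc,
    mul_one_div_cancel hW, one_mul, groupWeight_eq_groupSum, groupSum, groupSum, sum_mul,
    ← sum_sub_distrib]
  refine sum_congr rfl fun u _ => ?_
  rw [score]
  ring

namespace ChiSquareFinite

variable (hB : B.ChiSquareFinite)
include hB

lemma one_le_sigmaMax (i : Fin N) : 1 ≤ B.sigmaMax :=
  (hB.one_le_sigma i i).trans (B.sigma_le_sigmaMax i i)

lemma groupCount_le_sigmaMax_mul_groupWeight (i : Fin N) :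
    groupCount (D.assign t h) r t ≤ B.sigmaMax * B.groupWeight D t h i r := by
  rw [groupWeight_eq_groupSum, groupSum, groupCount, mul_sum, card_eq_sum_ones]
  push_cast
  refine sum_le_sum fun u _ => ?_
  rw [mul_one_div, one_le_div (hB.sigma_pos _ _)]
  exact B.sigma_le_sigmaMax _ _

lemma groupWeight_pos (hr : 1 ≤ D.size t h r) (i : Fin N) : 0 < B.groupWeight D t h i r := by
  have hcount := hB.groupCount_le_sigmaMax_mul_groupWeight (D := D) (t := t) (h := h) (r := r) i
  rw [← D.size_eq_groupCount] at hcount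
  have hsize : (1 : ℝ) ≤ D.size t h r := by exact_mod_cast hr
  exact pos_of_mul_pos_right (by linarith) (zero_le_one.trans (hB.one_le_sigmaMax i))

end ChiSquareFinite

section NonemptyGroups

variable (hsize : ∀ r < numGroups t, 1 ≤ D.size t h r)
include hsize

lemma minWeight_mul_groupCount_le (i : Fin N) (hr : r < numGroups t) :
    B.minWeight D t h i * groupCount (D.assign t h) r t ≤ B.groupWeight D t h i r := by
  have hpos : (0 : ℝ) < D.size t h r := by exact_mod_cast hsize r hr
  rw [← D.size_eq_groupCount, ← le_div_iff₀ hpos]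
  exact ciInf_le (Set.finite_range fun r : Fin (numGroups t) =>
    B.groupWeight D t h i r / (D.size t h r : ℝ)).bddBelow ⟨r, hr⟩

variable (hl : 1 ≤ numGroups t) (hB : B.ChiSquareFinite)
include hl hB

lemma ChiSquareFinite.inv_sigmaMax_le_minWeight (i : Fin N) :
    B.sigmaMax⁻¹ ≤ B.minWeight D t h i := by
  have : Nonempty (Fin (numGroups t)) := ⟨⟨0, hl⟩⟩
  refine le_ciInf fun r => ?_
  have hpos : (0 : ℝ) < D.size t h r := by exact_mod_cast hsize r r.2
  rw [inv_le_iff_one_le_mul₀' (by linarith [hB.one_le_sigmaMax i]), ← mul_div_assoc,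
    one_le_div hpos, D.size_eq_groupCount]
  exact hB.groupCount_le_sigmaMax_mul_groupWeight i

lemma ChiSquareFinite.minWeight_pos (i : Fin N) : 0 < B.minWeight D t h i :=
  (inv_pos.2 (zero_lt_one.trans_le (hB.one_le_sigmaMax i))).trans_le
    (hB.inv_sigmaMax_le_minWeight hsize hl i)

lemma ChiSquareFinite.groupCount_mul_radius_le (i : Fin N) (hr : r < numGroups t) :
    groupCount (D.assign t h) r t * radius t ≤ B.groupWeight D t h i r * B.width D t h i := by
  have hpos := hB.minWeight_pos hsize hl i
  calc groupCount (D.assign t h) r t * radius t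
      = B.minWeight D t h i * groupCount (D.assign t h) r t * B.width D t h i := by
        rw [width, ← radius]
        field_simp
    _ ≤ B.groupWeight D t h i r * B.width D t h i :=
        mul_le_mul_of_nonneg_right (minWeight_mul_groupCount_le hsize i hr)
          (mul_nonneg (one_div_nonneg.2 hpos.le) (radius_nonneg t))

lemma ChiSquareFinite.width_le (i : Fin N) : B.width D t h i ≤ B.sigmaMax * radius t := by
  refine mul_le_mul_of_nonneg_right ?_ (radius_nonneg t)
  rw [one_div]
  exact inv_le_of_inv_le₀ (zero_lt_one.trans_le (hB.one_le_sigmaMax i))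
    (hB.inv_sigmaMax_le_minWeight hsize hl i)

lemma ChiSquareFinite.numGroups_le_of_momEstimate_le {z : ℕ → 𝒳 × Fin K × ℝ} {i : Fin N}
    (hle : B.momEstimate D t h z i ≤ B.mean i - B.width D t h i) :
    numGroups t ≤ 2 * #{r ∈ range (numGroups t) | groupCount (D.assign t h) r t * radius t ≤
      groupSum (D.assign t h) (fun u => -B.score i (h u) (z u)) r t} := by
  rw [← card_filter_univ_fin]
  refine (le_two_mul_card_le_median fun r : Fin (numGroups t) => B.groupMean D t h z i r).trans
    (Nat.mul_le_mul_left 2 (card_le_card ?_))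
  refine monotone_filter_right _ fun r _ hr => ?_
  have hW := hB.groupWeight_pos (hsize r r.2) i
  refine (hB.groupCount_mul_radius_le hsize hl i r.2).trans ?_
  rw [groupSum, sum_neg_distrib, ← groupSum, groupSum_score hW.ne', ← mul_neg]
  exact mul_le_mul_of_nonneg_left (by linarith [hr.trans hle]) hW.le

lemma ChiSquareFinite.numGroups_le_of_le_momEstimate {z : ℕ → 𝒳 × Fin K × ℝ} {i : Fin N}
    (hle : B.mean i + 3 * B.width D t h i ≤ B.momEstimate D t h z i) :
    numGroups t ≤ 2 * #{r ∈ range (numGroups t) |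
      3 * (groupCount (D.assign t h) r t * radius t) ≤
        groupSum (D.assign t h) (fun u => B.score i (h u) (z u)) r t} := by
  rw [← card_filter_univ_fin]
  refine (le_two_mul_card_median_le fun r : Fin (numGroups t) => B.groupMean D t h z i r).trans
    (Nat.mul_le_mul_left 2 (card_le_card ?_))
  refine monotone_filter_right _ fun r _ hr => ?_
  have hW := hB.groupWeight_pos (hsize r r.2) i
  rw [groupSum_score hW.ne']
  have hwidth : 3 * B.width D t h i ≤ B.groupMean D t h z i r - B.mean i := by
    linarith [hle.trans hr]
  linarith [hB.groupCount_mul_radius_le hsize hl i r.2, mul_le_mul_of_nonneg_left hwidth hW.le]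

end NonemptyGroups

end ExpertBandit

section GroupSizes

variable {t : ℕ}

lemma log_one_div_delta (t : ℕ) : Real.log (1 / delta t) = 2 * Real.log t := by
  rw [delta, one_div_one_div, Real.log_pow, Nat.cast_ofNat]

lemma radius_sq (t : ℕ) : radius t ^ 2 = 128 * Real.log t / t := by
  have := Real.log_natCast_nonneg t
  rw [radius, log_one_div_delta, Real.sq_sqrt (by positivity)]
  ring

lemma numGroups_le (t : ℕ) : (numGroups t : ℝ) ≤ 16 * Real.log t := by
  have := Real.log_natCast_nonneg t
  rw [numGroups, log_one_div_delta]
  exact (Nat.floor_le (by positivity)).trans (by linarith)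

lemma lt_numGroups_add_one (t : ℕ) : 16 * Real.log t < numGroups t + 1 := by
  rw [numGroups, log_one_div_delta]
  linarith [Nat.lt_floor_add_one (8 * (2 * Real.log t))]

/-- A time from which on all groups are nonempty and the radius is at most `1 / 2`. -/
def burnIn : ℕ := 2 ^ 13

variable (ht : burnIn ≤ t)
include ht

lemma cast_burnIn_le : (2 : ℝ) ^ 13 ≤ t := by exact_mod_cast ht

lemma nine_le_log : 9 ≤ Real.log t := by
  have hmono := Real.log_le_log (by norm_num) (cast_burnIn_le ht)
  rw [Real.log_pow] at hmono
  norm_num at hmono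
  linarith [Real.log_two_gt_d9]

lemma mul_log_le_self : 512 * Real.log t ≤ t := by
  have ht' := cast_burnIn_le ht
  have htangent := Real.log_le_sub_one_of_pos (x := t / 2 ^ 13) (by linarith)
  rw [Real.log_div (by linarith) (by norm_num), Real.log_pow] at htangent
  norm_num at htangent
  linarith [Real.log_two_lt_d9]

lemma radius_le_half : radius t ≤ 1 / 2 := by
  refine abs_le_of_sq_le_sq' ?_ (by norm_num) |>.2
  have ht' := cast_burnIn_le ht
  rw [radius_sq, div_le_iff₀ (by linarith)]
  linarith [mul_log_le_self ht]

lemma one_le_numGroups : 1 ≤ numGroups t := by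
  have hpos : (0 : ℝ) < numGroups t := by linarith [lt_numGroups_add_one t, nine_le_log ht]
  exact_mod_cast hpos

lemma le_groupSize_mul_radius_sq :
    15 / 4 ≤ ((t / (2 * numGroups t) : ℕ) : ℝ) * radius t ^ 2 := by
  have := nine_le_log ht
  have ht' := cast_burnIn_le ht
  have hlt : t < (t / (2 * numGroups t) + 1) * (2 * numGroups t) :=
    (Nat.div_lt_iff_lt_mul (by have := one_le_numGroups ht; lia)).1 (Nat.lt_succ_self _)
  have hsize : (t : ℝ) ≤ ((t / (2 * numGroups t) : ℕ) + 1) * (32 * Real.log t) := by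
    calc (t : ℝ) ≤ ((t / (2 * numGroups t) : ℕ) + 1) * (2 * numGroups t) := by exact_mod_cast hlt.le
      _ ≤ _ := by
        refine mul_le_mul_of_nonneg_left ?_ (by positivity)
        linarith [numGroups_le t]
  rw [radius_sq, mul_div_assoc', le_div_iff₀ (by linarith)]
  linarith [mul_log_le_self ht]

lemma one_le_groupSize : 1 ≤ t / (2 * numGroups t) := by
  by_contra! hlt
  have hle := le_groupSize_mul_radius_sq ht
  norm_num [Nat.lt_one_iff.1 hlt] at hle

lemma sqrt_three_div_two_pow_numGroups_le : (√3 / 2) ^ numGroups t ≤ 1 / (2 * (t : ℝ) ^ 2) := by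
  have ht' := cast_burnIn_le ht
  have hbase : √3 / 2 ≤ Real.exp (-(9 / 64)) := by
    have hexp : Real.exp (9 / 64 * 2) ≤ 4 / 3 :=
      (exp_le_one_add_add_sq (by norm_num)).trans (by norm_num)
    refine (pow_le_pow_iff_left₀ (by positivity) (by positivity) two_ne_zero).1 ?_
    calc (√3 / 2) ^ 2 = (4 / 3)⁻¹ := by
          rw [div_pow, Real.sq_sqrt (by norm_num)]
          norm_num
      _ ≤ (Real.exp (9 / 64 * 2))⁻¹ := inv_anti₀ (Real.exp_pos _) hexp
      _ = Real.exp (-(9 / 64)) ^ 2 := by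
          rw [← Real.exp_neg, ← Real.exp_nat_mul]
          norm_num
  calc (√3 / 2) ^ numGroups t ≤ Real.exp (-(9 / 64)) ^ numGroups t :=
        pow_le_pow_left₀ (by positivity) hbase _
    _ = Real.exp (-(9 / 64 * numGroups t)) := by
        rw [← Real.exp_nat_mul]
        ring_nf
    _ ≤ Real.exp (-(Real.log 2 + 2 * Real.log t)) := by
        refine Real.exp_le_exp.2 ?_
        linarith [lt_numGroups_add_one t, nine_le_log ht, Real.log_two_lt_d9]
    _ = 1 / (2 * (t : ℝ) ^ 2) := by
        rw [Real.exp_neg, Real.exp_add, Real.exp_log two_pos, ← Nat.cast_ofNat, Real.exp_nat_mul,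
          Real.exp_log (by linarith), one_div]

end GroupSizes

lemma comap_le_pastInfo {Ω 𝒳 : Type*} [MeasurableSpace 𝒳] {K N : ℕ} {k : ℕ → Ω → Fin N}
    {Z : ℕ → Ω → 𝒳 × Fin K × ℝ} {s t : ℕ} (hs : s ∈ Ico 1 t) :
    MeasurableSpace.comap (k s) inferInstance ⊔ MeasurableSpace.comap (Z s) inferInstance ≤
      pastInfo k Z t :=
  le_iSup₂ (f := fun s (_ : s ∈ Ico 1 t) =>
    MeasurableSpace.comap (k s) inferInstance ⊔ MeasurableSpace.comap (Z s) inferInstance) s hs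

section AdaptiveSampling

variable {Ω 𝒳 : Type*} [mΩ : MeasurableSpace Ω] [MeasurableSpace 𝒳] {K N : ℕ}
  {B : ExpertBandit 𝒳 K N} {D : Division N} {P : Measure Ω}
  {k : ℕ → Ω → Fin N} {Z : ℕ → Ω → 𝒳 × Fin K × ℝ}

lemma IsAdaptiveSample.measurable_assign {𝓕 : Filtration ℕ mΩ} {α : Type*} [MeasurableSpace α]
    {ν : Kernel (Fin N) α} {Z : ℕ → Ω → α} (h : IsAdaptiveSample P 𝓕 ν k Z) (t s : ℕ) :
    Measurable[𝓕 s] fun ω => D.assign t (fun u => k u ω) (s + 1) := by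
  have hdep : DependsOn (fun h => D.assign t h (s + 1)) (Icc 1 (s + 1) : Finset ℕ) :=
    fun h h' hh => D.assign_congr t h h' (s + 1) hh
  refine measurable_comp_of_dependsOn hdep fun u hu => ?_
  obtain ⟨hu1, hus⟩ := mem_Icc.1 hu
  obtain ⟨u, rfl⟩ := Nat.exists_eq_add_of_le' hu1
  exact (h.measurable_index u).mono (𝓕.mono (Nat.le_of_succ_le_succ hus)) le_rfl

instance (B : ExpertBandit 𝒳 K N) : IsMarkovKernel (Kernel.ofFunOfCountable B.law) :=
  ⟨fun j => inferInstanceAs (IsProbabilityMeasure (B.law j))⟩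

namespace IsDUCBRun

variable (hrun : IsDUCBRun B D P k Z)
include hrun

lemma pastInfo_le (t : ℕ) : pastInfo k Z t ≤ mΩ :=
  iSup₂_le fun s _ =>
    sup_le (hrun.measurable_expert s).comap_le (hrun.measurable_obs s).comap_le

/-- The information at time `s + 1` after the expert `k (s + 1)` has been chosen and before its
observation is made. -/
def filtration : Filtration ℕ mΩ where
  seq s := pastInfo k Z (s + 1) ⊔ MeasurableSpace.comap (k (s + 1)) inferInstance
  mono' := monotone_nat_of_le_succ fun s =>
    sup_le ((biSup_mono fun u hu => mem_Ico.2 (by have := mem_Ico.1 hu; lia)).trans le_sup_left)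
      ((le_sup_left.trans (comap_le_pastInfo (mem_Ico.2 (by lia)))).trans le_sup_left)
  le' s := sup_le (hrun.pastInfo_le _) (hrun.measurable_expert _).comap_le

lemma measure_inter_fiber {s : ℕ} {A : Set Ω} {S : Set (𝒳 × Fin K × ℝ)}
    (hA : MeasurableSet[hrun.filtration s] A) (hS : MeasurableSet S) (j : Fin N) :
    P (A ∩ k (s + 1) ⁻¹' {j} ∩ Z (s + 1) ⁻¹' S) = P (A ∩ k (s + 1) ⁻¹' {j}) * B.law j S := by
  obtain ⟨A', hA', heq⟩ := exists_measurableSet_inter_fiber_eq hA j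
  rw [← heq]
  exact hrun.observe (s + 1) (Nat.le_add_left 1 s) A' hA' j S hS

lemma isAdaptiveSample :
    IsAdaptiveSample P hrun.filtration (Kernel.ofFunOfCountable B.law) k Z where
  measurable_index s := (comap_measurable (k (s + 1))).mono le_sup_right le_rfl
  measurable_sample s := (comap_measurable (Z (s + 1))).mono
    ((le_sup_right.trans (comap_le_pastInfo (mem_Ico.2 (by lia)))).trans le_sup_left) le_rfl
  measure_inter s A S hA hS := by
    have hk := hrun.measurable_expert (s + 1)
    calc P (A ∩ Z (s + 1) ⁻¹' S)
        = ∑ j, P (A ∩ k (s + 1) ⁻¹' {j} ∩ Z (s + 1) ⁻¹' S) := by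
          have hsum := sum_measure_preimage_singleton (μ := P.restrict (A ∩ Z (s + 1) ⁻¹' S)) univ
            fun j _ => hk (measurableSet_singleton j)
          simp only [coe_univ, Set.preimage_univ, Measure.restrict_apply_univ] at hsum
          rw [← hsum]
          refine sum_congr rfl fun j _ => ?_
          rw [Measure.restrict_apply (hk (measurableSet_singleton j)), ← Set.inter_assoc,
            Set.inter_comm _ A]
      _ = ∑ j, B.law j S * P (A ∩ k (s + 1) ⁻¹' {j}) :=
          sum_congr rfl fun j _ => by rw [hrun.measure_inter_fiber hA hS j, mul_comm]
      _ = ∫⁻ j, B.law j S ∂(P.restrict A).map (k (s + 1)) := by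
          rw [lintegral_fintype]
          refine sum_congr rfl fun j _ => ?_
          rw [Measure.map_apply hk (measurableSet_singleton j),
            Measure.restrict_apply (hk (measurableSet_singleton j)), Set.inter_comm]
      _ = ∫⁻ ω in A, Kernel.ofFunOfCountable B.law (k (s + 1) ω) S ∂P :=
          lintegral_map Measurable.of_discrete hk

end IsDUCBRun

end AdaptiveSampling

lemma Division.one_le_size {N : ℕ} (D : Division N) {t : ℕ} (ht : burnIn ≤ t) (h : ℕ → Fin N)
    {r : ℕ} (hr : r < numGroups t) : 1 ≤ D.size t h r := by
  rw [D.size_eq_groupCount]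
  exact (one_le_groupSize ht).trans (D.group_size t h r hr)

namespace IsDUCBRun

variable {Ω 𝒳 : Type*} [MeasurableSpace Ω] [MeasurableSpace 𝒳] {K N : ℕ}
  {B : ExpertBandit 𝒳 K N} {D : Division N} {P : Measure Ω} [IsProbabilityMeasure P]
  {k : ℕ → Ω → Fin N} {Z : ℕ → Ω → 𝒳 × Fin K × ℝ} (hrun : IsDUCBRun B D P k Z)
  (hB : B.ChiSquareFinite) {t : ℕ} (ht : burnIn ≤ t)
include hrun hB ht

lemma measure_momEstimate_le_le (i : Fin N) :
    P.real {ω | B.momEstimate D t (fun s => k s ω) (fun s => Z s ω) i ≤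
      B.mean i - B.width D t (fun s => k s ω) i} ≤ 1 / (2 * (t : ℝ) ^ 2) := by
  refine (measureReal_mono fun ω hω => ?_).trans
    ((hrun.isAdaptiveSample.measure_half_groupSum_ge_le_of_le_one
      (d := fun j z => -B.score i j z) (B.measurable_score i).neg
      (fun j => (hB.isNormalizedScore i j).neg) (hB.ae_neg_score_le_one i)
      (hrun.isAdaptiveSample.measurable_assign (D := D) t) (radius_nonneg t)
      (by linarith [radius_le_half ht]) (le_groupSize_mul_radius_sq ht)
      fun ω => D.group_size t fun s => k s ω).trans (sqrt_three_div_two_pow_numGroups_le ht))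
  exact hB.numGroups_le_of_momEstimate_le (fun r hr => D.one_le_size ht _ hr)
    (one_le_numGroups ht) hω

lemma measure_le_momEstimate_le (i : Fin N) :
    P.real {ω | B.mean i + 3 * B.width D t (fun s => k s ω) i ≤
      B.momEstimate D t (fun s => k s ω) (fun s => Z s ω) i} ≤ 1 / (2 * (t : ℝ) ^ 2) := by
  refine (measureReal_mono fun ω hω => ?_).trans
    ((hrun.isAdaptiveSample.measure_half_groupSum_ge_le (B.measurable_score i)
      (hB.isNormalizedScore i) (hrun.isAdaptiveSample.measurable_assign (D := D) t)
      (radius_nonneg t) (by linarith [le_groupSize_mul_radius_sq ht])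
      fun ω => D.group_size t fun s => k s ω).trans (sqrt_three_div_two_pow_numGroups_le ht))
  exact hB.numGroups_le_of_le_momEstimate (fun r hr => D.one_le_size ht _ hr)
    (one_le_numGroups ht) hω

lemma measure_expert_le {j : Fin N} (hgap : 4 * (B.sigmaMax * radius t) ≤ B.gap j) :
    P.real (k (t + 1) ⁻¹' {j}) ≤ 1 / (t : ℝ) ^ 2 := by
  have : Nonempty (Fin N) := ⟨j⟩
  obtain ⟨i, hi⟩ := exists_eq_ciSup_of_finite (f := B.mean)
  have hsub : k (t + 1) ⁻¹' {j} ≤ᵐ[P]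
      ({ω | B.momEstimate D t (fun s => k s ω) (fun s => Z s ω) i ≤
        B.mean i - B.width D t (fun s => k s ω) i} ∪
      {ω | B.mean j + 3 * B.width D t (fun s => k s ω) j ≤
        B.momEstimate D t (fun s => k s ω) (fun s => Z s ω) j} : Set Ω) := by
    filter_upwards [hrun.choose t (Nat.one_le_two_pow.trans ht)] with ω hω hkj
    by_contra! hnot
    have hnot' := not_or.1 hnot
    simp only [Set.mem_ofPred_eq, not_le] at hnot'
    have hsize : ∀ r < numGroups t, 1 ≤ D.size t (fun s => k s ω) r :=
      fun r hr => D.one_le_size ht _ hr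
    have hucb := hω (one_le_numGroups ht) hsize i
    have hwidth := hB.width_le hsize (one_le_numGroups ht) j
    rw [show k (t + 1) ω = j from hkj, ExpertBandit.ucb, ExpertBandit.ucb] at hucb
    rw [ExpertBandit.gap, ExpertBandit.bestMean, ← hi] at hgap
    linarith [hnot'.1, hnot'.2]
  calc P.real (k (t + 1) ⁻¹' {j}) ≤ _ := ENNReal.toReal_mono (measure_ne_top _ _)
        (measure_mono_ae hsub)
    _ ≤ 1 / (2 * (t : ℝ) ^ 2) + 1 / (2 * (t : ℝ) ^ 2) := (measureReal_union_le _ _).trans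
        (add_le_add (hrun.measure_momEstimate_le_le hB ht i)
          (hrun.measure_le_momEstimate_le hB ht j))
    _ = 1 / (t : ℝ) ^ 2 := by ring

end IsDUCBRun

namespace ExpertBandit

variable {𝒳 : Type*} [MeasurableSpace 𝒳] {K N : ℕ} (B : ExpertBandit 𝒳 K N)

lemma gap_mem_Icc (i : Fin N) : B.gap i ∈ Set.Icc (0 : ℝ) 1 := by
  have : Nonempty (Fin N) := ⟨i⟩
  obtain ⟨b, hb⟩ := exists_eq_ciSup_of_finite (f := B.mean)
  refine ⟨sub_nonneg.2 (le_ciSup (Set.finite_range B.mean).bddAbove i), ?_⟩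
  rw [gap, bestMean, ← hb]
  linarith [(B.mean_mem_Icc b).2, (B.mean_mem_Icc i).1]

lemma sortedGap_succ (i : Fin N) : B.sortedGap (i + 1) = B.gap (Tuple.sort B.gap i) := by
  rw [sortedGap, dif_pos ⟨by lia, i.2⟩]
  rfl

lemma sortedGap_mem_Icc (p : ℕ) : B.sortedGap p ∈ Set.Icc (0 : ℝ) 1 := by
  rw [sortedGap]
  split_ifs
  · exact B.gap_mem_Icc _
  · exact Set.left_mem_Icc.2 zero_le_one

lemma monotoneOn_sortedGap : MonotoneOn B.sortedGap (Set.Icc 1 N) := by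
  rintro p ⟨hp1, hpN⟩ q ⟨hq1, hqN⟩ hpq
  rw [sortedGap, sortedGap, dif_pos ⟨hp1, hpN⟩, dif_pos ⟨hq1, hqN⟩]
  exact Tuple.monotone_sort B.gap (Fin.mk_le_mk.2 (by lia))

lemma exists_sortedGap_eq (j : Fin N) : ∃ p ∈ Set.Icc 1 N, B.sortedGap p = B.gap j :=
  ⟨(Tuple.sort B.gap).symm j + 1, ⟨by lia, by lia⟩, by
    rw [sortedGap_succ, Equiv.apply_symm_apply]⟩

lemma sortedGap_one : B.sortedGap 1 = 0 := by
  rcases N.eq_zero_or_pos with rfl | hN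
  · rw [sortedGap, dif_neg (by lia)]
  · have : Nonempty (Fin N) := ⟨⟨0, hN⟩⟩
    obtain ⟨b, hb⟩ := exists_eq_ciSup_of_finite (f := B.mean)
    obtain ⟨p, hp, hpb⟩ := B.exists_sortedGap_eq b
    refine le_antisymm ?_ (B.sortedGap_mem_Icc 1).1
    calc B.sortedGap 1 ≤ B.sortedGap p := B.monotoneOn_sortedGap ⟨le_rfl, hN⟩ hp hp.1
      _ = 0 := by rw [hpb, gap, bestMean, hb, sub_self]

lemma sum_sortedGap : ∑ i ∈ Icc 2 N, B.sortedGap i = ∑ j, B.gap j := by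
  rw [← Equiv.sum_comp (Tuple.sort B.gap) B.gap]
  simp_rw [← sortedGap_succ]
  rw [Fin.sum_univ_eq_sum_range (fun i => B.sortedGap (i + 1)) N]
  cases N with
  | zero => rfl
  | succ n =>
    rw [sum_range_succ', zero_add, B.sortedGap_one, add_zero, range_eq_Ico,
      sum_Ico_add' (fun i => B.sortedGap (i + 1)) 0 n 1, sum_Ico_add' B.sortedGap (0 + 1) (n + 1) 1]
    rfl

end ExpertBandit

section Layers

variable {g : ℕ → ℝ} {n : ℕ}

/-- The part of a sequence `0 = g 1 ≤ g 2 ≤ … ≤ g n` of gaps that is not yet resolved at time `s`: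
the sum of the layers from `g (i - 1)` to `g i` with `s * g i ^ 2 < M`. -/
noncomputable def unresolvedLayers (g : ℕ → ℝ) (n : ℕ) (M : ℝ) (s : ℕ) : ℝ :=
  ∑ i ∈ Icc 2 n with s * g i ^ 2 < M, (g i - g (i - 1))

lemma sum_layers (g : ℕ → ℝ) {p : ℕ} (hp : 1 ≤ p) :
    ∑ i ∈ Icc 2 p, (g i - g (i - 1)) = g p - g 1 := by
  induction p, hp using Nat.le_induction with
  | base => simp
  | succ p hp ih =>
    rw [sum_Icc_succ_top (by lia), ih, Nat.add_sub_cancel]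
    ring

lemma layer_nonneg (hmono : MonotoneOn g (Set.Icc 1 n)) {i : ℕ} (hi : i ∈ Icc 2 n) :
    0 ≤ g i - g (i - 1) := by
  obtain ⟨hi2, hin⟩ := mem_Icc.1 hi
  exact sub_nonneg.2 (hmono ⟨by lia, by lia⟩ ⟨by lia, hin⟩ (Nat.sub_le i 1))

lemma unresolvedLayers_nonneg (hmono : MonotoneOn g (Set.Icc 1 n)) (M : ℝ) (s : ℕ) :
    0 ≤ unresolvedLayers g n M s :=
  sum_nonneg fun _ hi => layer_nonneg hmono (mem_filter.1 hi).1

lemma le_unresolvedLayers (hmono : MonotoneOn g (Set.Icc 1 n)) (h1 : g 1 = 0) {M : ℝ} {s p : ℕ}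
    (hp : p ∈ Set.Icc 1 n) (h : s * g p ^ 2 < M) : g p ≤ unresolvedLayers g n M s := by
  have hunresolved : ∀ i ∈ Icc 2 p, s * g i ^ 2 < M := by
    intro i hi
    obtain ⟨hi2, hip⟩ := mem_Icc.1 hi
    have hin : i ∈ Set.Icc 1 n := ⟨by lia, hip.trans hp.2⟩
    have hpos : 0 ≤ g i := h1 ▸ hmono ⟨le_rfl, hp.1.trans hp.2⟩ hin hin.1
    have hle : g i ≤ g p := hmono hin hp hip
    exact lt_of_le_of_lt (by gcongr) h
  calc g p = ∑ i ∈ Icc 2 p, (g i - g (i - 1)) := by rw [sum_layers g hp.1, h1, sub_zero]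
    _ ≤ unresolvedLayers g n M s := sum_le_sum_of_subset_of_nonneg
        (fun i hi => mem_filter.2 ⟨Icc_subset_Icc_right hp.2 hi, hunresolved i hi⟩)
        fun i hi _ => layer_nonneg hmono (mem_filter.1 hi).1

lemma card_filter_cast_lt_le {τ : ℝ} (hτ : 0 ≤ τ) (m : ℕ) :
    (#{s ∈ Icc 1 m | ((s : ℕ) : ℝ) < τ} : ℝ) ≤ τ := by
  have hsub : {s ∈ Icc 1 m | ((s : ℕ) : ℝ) < τ} ⊆ Icc 1 ⌊τ⌋₊ := fun s hs =>
    mem_Icc.2 ⟨(mem_Icc.1 (mem_filter.1 hs).1).1, Nat.le_floor (mem_filter.1 hs).2.le⟩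
  have hcard := card_le_card hsub
  rw [Nat.card_Icc, Nat.add_sub_cancel] at hcard
  exact (Nat.cast_le.2 hcard).trans (Nat.floor_le hτ)

lemma sum_unresolvedLayers_le (hmono : MonotoneOn g (Set.Icc 1 n)) (h1 : g 1 = 0) {M : ℝ}
    (hM : 0 ≤ M) (m : ℕ) :
    ∑ s ∈ Icc 1 m, unresolvedLayers g n M s ≤ ∑ i ∈ Icc 2 n, (g i - g (i - 1)) * (M / g i ^ 2) := by
  simp only [unresolvedLayers, sum_filter]
  rw [sum_comm]
  refine sum_le_sum fun i hi => ?_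
  obtain ⟨hi2, hin⟩ := mem_Icc.1 hi
  have hprev : 0 ≤ g (i - 1) := h1 ▸ hmono ⟨le_rfl, by lia⟩ ⟨by lia, by lia⟩ (by lia)
  rcases eq_or_ne (g i) 0 with h0 | h0
  · have hlayer : g i - g (i - 1) = 0 := le_antisymm (by linarith) (layer_nonneg hmono hi)
    simp [hlayer]
  · rw [← sum_filter, sum_const, nsmul_eq_mul, mul_comm]
    simp only [← lt_div_iff₀ (sq_pos_of_ne_zero h0)]
    exact mul_le_mul_of_nonneg_left (card_filter_cast_lt_le (by positivity) m)
      (layer_nonneg hmono hi)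

lemma sum_layers_mul_div_sq (M : ℝ) (h1 : g 1 = 0) (hn : 1 ≤ n)
    (hmono : MonotoneOn g (Set.Icc 1 n)) :
    ∑ i ∈ Icc 2 n, (g i - g (i - 1)) * (M / g i ^ 2) =
      M / g n + ∑ i ∈ Icc 2 (n - 1), M / g i * (1 - g i ^ 2 / g (i + 1) ^ 2) := by
  induction n, hn using Nat.le_induction with
  | base => simp [h1]
  | succ n hn ih =>
    have hsum : ∑ i ∈ Icc 2 n, M / g i * (1 - g i ^ 2 / g (i + 1) ^ 2) =
        ∑ i ∈ Icc 2 (n - 1), M / g i * (1 - g i ^ 2 / g (i + 1) ^ 2) +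
          M / g n * (1 - g n ^ 2 / g (n + 1) ^ 2) := by
      obtain ⟨m, rfl⟩ := Nat.exists_eq_add_of_le' hn
      rcases m.eq_zero_or_pos with rfl | hm
      · simp [h1]
      · rw [sum_Icc_succ_top (by lia), Nat.add_sub_cancel]
    have hnonneg : 0 ≤ g n := h1 ▸ hmono ⟨le_rfl, by lia⟩ ⟨hn, by lia⟩ hn
    have hstep : g n ≤ g (n + 1) := hmono ⟨hn, by lia⟩ ⟨by lia, le_rfl⟩ n.le_succ
    rw [sum_Icc_succ_top (by lia), ih (hmono.mono (Set.Icc_subset_Icc_right n.le_succ)),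
      Nat.add_sub_cancel, hsum]
    rcases eq_or_ne (g (n + 1)) 0 with hsucc | hsucc
    · have hzero : g n = 0 := le_antisymm (hsucc ▸ hstep) hnonneg
      simp [hsucc, hzero]
    · rcases eq_or_ne (g n) 0 with hzero | hzero
      · rw [hzero]
        field_simp
        ring
      · field_simp
        ring

end Layers

lemma sum_one_div_sq_le (m : ℕ) : ∑ s ∈ Icc 1 m, 1 / (s : ℝ) ^ 2 ≤ Real.pi ^ 2 / 6 :=
  sum_le_hasSum _ (fun s _ => by positivity) hasSum_zeta_two

namespace IsDUCBRun

variable {Ω 𝒳 : Type*} [MeasurableSpace Ω] [MeasurableSpace 𝒳] {K N : ℕ}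
  {B : ExpertBandit 𝒳 K N} {D : Division N} {P : Measure Ω} [IsProbabilityMeasure P]
  {k : ℕ → Ω → Fin N} {Z : ℕ → Ω → 𝒳 × Fin K × ℝ} (hrun : IsDUCBRun B D P k Z)
include hrun

lemma measure_expert_le_of_le_mul_gap_sq (hB : B.ChiSquareFinite) {s T : ℕ} (hs : 1 ≤ s)
    (hsT : s < T) {j : Fin N} (h : 2 ^ 14 * B.sigmaMax ^ 2 * Real.log T ≤ s * B.gap j ^ 2) :
    P.real (k (s + 1) ⁻¹' {j}) ≤ 1 / (s : ℝ) ^ 2 := by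
  obtain ⟨hgap0, hgap1⟩ := B.gap_mem_Icc j
  have hs0 : (0 : ℝ) < s := by exact_mod_cast hs
  have hσ : 1 ≤ B.sigmaMax ^ 2 := one_le_pow₀ (hB.one_le_sigmaMax j)
  have hlogT : 1 / 2 ≤ Real.log T := by
    have : Real.log 2 ≤ Real.log T := Real.log_le_log two_pos (by exact_mod_cast hs.trans_lt hsT)
    linarith [Real.log_two_gt_d9]
  have hburn : burnIn ≤ s := by
    have : (2 : ℝ) ^ 13 ≤ s := by
      calc (2 : ℝ) ^ 13 = 2 ^ 14 * 1 * (1 / 2) := by norm_num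
        _ ≤ 2 ^ 14 * B.sigmaMax ^ 2 * Real.log T := by gcongr
        _ ≤ s * B.gap j ^ 2 := h
        _ ≤ s := mul_le_of_le_one_right hs0.le (pow_le_one₀ hgap0 hgap1)
    exact_mod_cast this
  refine hrun.measure_expert_le hB hburn (le_of_sq_le_sq ?_ hgap0)
  calc (4 * (B.sigmaMax * radius s)) ^ 2 = 2 ^ 11 * B.sigmaMax ^ 2 * Real.log s / s := by
        rw [mul_pow, mul_pow, radius_sq]
        ring
    _ ≤ 2 ^ 14 * B.sigmaMax ^ 2 * Real.log T / s := by
        have : 0 ≤ Real.log s := Real.log_natCast_nonneg s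
        gcongr
        · exact one_le_two
        · norm_num
    _ ≤ B.gap j ^ 2 := (div_le_iff₀' hs0).2 h

lemma integral_gap_le_sum (t : ℕ) : ∫ ω, B.gap (k t ω) ∂P ≤ ∑ j, B.gap j := by
  simpa only [zero_add, one_mul] using integral_comp_le_add_mul_sum (hrun.measurable_expert t)
    (fun j => (B.gap_mem_Icc j).1) le_rfl zero_le_one fun j => .inr measureReal_le_one

lemma integral_gap_succ_le (hB : B.ChiSquareFinite) {s T : ℕ} (hs : 1 ≤ s) (hsT : s < T) :
    ∫ ω, B.gap (k (s + 1) ω) ∂P ≤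
      unresolvedLayers B.sortedGap N (2 ^ 14 * B.sigmaMax ^ 2 * Real.log T) s +
        1 / (s : ℝ) ^ 2 * ∑ j, B.gap j := by
  refine integral_comp_le_add_mul_sum (hrun.measurable_expert _) (fun j => (B.gap_mem_Icc j).1)
    (unresolvedLayers_nonneg B.monotoneOn_sortedGap _ s) (by positivity) fun j => ?_
  rcases le_or_gt (2 ^ 14 * B.sigmaMax ^ 2 * Real.log T) (s * B.gap j ^ 2) with h | h
  · exact .inr (hrun.measure_expert_le_of_le_mul_gap_sq hB hs hsT h)
  · obtain ⟨p, hp, hpj⟩ := B.exists_sortedGap_eq j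
    rw [← hpj] at h ⊢
    exact .inl (le_unresolvedLayers B.monotoneOn_sortedGap B.sortedGap_one hp h)

lemma regret_eq (T : ℕ) : regret B P k T = ∑ t ∈ Icc 1 T, ∫ ω, B.gap (k t ω) ∂P :=
  integral_finsetSum _ fun t _ => Integrable.of_mem_Icc 0 1
    ((Measurable.of_discrete (f := B.gap)).comp (hrun.measurable_expert t)).aemeasurable
    (.of_forall fun _ => B.gap_mem_Icc _)

lemma regret_le (hB : B.ChiSquareFinite) {T : ℕ} (hT : 1 ≤ T) :
    regret B P k T ≤ ∑ s ∈ Icc 1 (T - 1),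
        unresolvedLayers B.sortedGap N (2 ^ 14 * B.sigmaMax ^ 2 * Real.log T) s +
      Real.pi ^ 2 / 3 * ∑ j, B.gap j := by
  have hgap : 0 ≤ ∑ j, B.gap j := sum_nonneg fun j _ => (B.gap_mem_Icc j).1
  have hlater : ∑ t ∈ Ioc 1 T, ∫ ω, B.gap (k t ω) ∂P ≤ ∑ s ∈ Icc 1 (T - 1),
      unresolvedLayers B.sortedGap N (2 ^ 14 * B.sigmaMax ^ 2 * Real.log T) s +
        Real.pi ^ 2 / 6 * ∑ j, B.gap j := by
    obtain ⟨n, rfl⟩ := Nat.exists_eq_add_of_le' hT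
    calc ∑ t ∈ Ioc 1 (n + 1), ∫ ω, B.gap (k t ω) ∂P
        = ∑ s ∈ Icc 1 n, ∫ ω, B.gap (k (s + 1) ω) ∂P :=
          (sum_Ico_add' (fun s => ∫ ω, B.gap (k s ω) ∂P) 1 (n + 1) 1).symm
      _ ≤ ∑ s ∈ Icc 1 n, (unresolvedLayers B.sortedGap N
            (2 ^ 14 * B.sigmaMax ^ 2 * Real.log (n + 1 : ℕ)) s +
            1 / (s : ℝ) ^ 2 * ∑ j, B.gap j) := sum_le_sum fun s hs =>
          hrun.integral_gap_succ_le hB (mem_Icc.1 hs).1 (Nat.lt_succ_of_le (mem_Icc.1 hs).2)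
      _ ≤ _ := by
          rw [sum_add_distrib, ← sum_mul, Nat.add_sub_cancel]
          gcongr
          exact sum_one_div_sq_le n
  have hpi : 1 + Real.pi ^ 2 / 6 ≤ Real.pi ^ 2 / 3 := by nlinarith [Real.pi_gt_three]
  rw [hrun.regret_eq, ← add_sum_Ioc_eq_sum_Icc hT]
  linarith [hrun.integral_gap_le_sum 1, mul_le_mul_of_nonneg_right hpi hgap]

end IsDUCBRun

theorem theorem2 : ∃ C₂ : ℝ, 0 < C₂ ∧
    ∀ (𝒳 Ω : Type*) [MeasurableSpace 𝒳] [MeasurableSpace Ω] (K N : ℕ)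
      (B : ExpertBandit 𝒳 K N) (D : Division N)
      (P : Measure Ω) [IsProbabilityMeasure P]
      (k : ℕ → Ω → Fin N) (Z : ℕ → Ω → 𝒳 × Fin K × ℝ),
      B.ChiSquareFinite → IsDUCBRun B D P k Z →
      ∀ T : ℕ, 1 ≤ T →
        regret B P k T ≤
          C₂ * B.sigmaMax ^ 2 * Real.log T / B.sortedGap N +
          ∑ i ∈ Finset.Icc 2 (N - 1),
            C₂ * B.sigmaMax ^ 2 * Real.log T / B.sortedGap i *
              (1 - B.sortedGap i ^ 2 / B.sortedGap (i + 1) ^ 2) +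
          Real.pi ^ 2 / 3 * ∑ i ∈ Finset.Icc 2 N, B.sortedGap i := by
  refine ⟨2 ^ 14, by positivity, fun 𝒳 Ω _ _ K N B D P _ k Z hB hrun T hT => ?_⟩
  obtain ⟨ω⟩ : Nonempty Ω := P.nonempty_of_neZero
  have hN : 1 ≤ N := Fin.pos (k 1 ω)
  rw [← sum_layers_mul_div_sq _ B.sortedGap_one hN B.monotoneOn_sortedGap, B.sum_sortedGap]
  refine (hrun.regret_le hB hT).trans (add_le_add_left ?_ _)
  exact sum_unresolvedLayers_le B.monotoneOn_sortedGap B.sortedGap_one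
    (by have := Real.log_natCast_nonneg T; positivity) _
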